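/- All trees are finite. A contraction $S\to T$ of trees is a map on vertices that sends each edge to an edge or to a vertex and such that the preimage of every vertex of $T$ is the vertex set of a (nonempty) subtree of $S$. Let $\mathcal{T}$ be the category of trees with contractions, $\mathcal{RT}$ the category of rooted trees with root-preserving contractions, and, for $l\ge 2$, $\mathcal{T}_l\subset\mathcal{T}$ the full subcategory of trees with at most $l$ leaves. Let $k$ be a field. For $\mathcal{C}$ one of $\mathcal{T}^{\mathrm{op}}$, $\mathcal{RT}^{\mathrm{op}}$, $\mathcal{T}_l^{\mathrm{op}}$, a $\mathcal{C}$-module is a functor from $\mathcal{C}$ to $k$-vector spaces, and the principal projective $P_x$ is the module for which $P_x(y)$ is the $k$-vector space with basis $\mathrm{Hom}_{\mathcal{C}}(x,y)$. A $\mathcal{C}$-module is generated in degrees $\le d$ if it is a quotient of a finite direct sum of modules $P_x$ where each $x$ is a (rooted) tree with at most $d$ edges; it is $d$-small if it is isomorphic to a subquotient of a module generated in degrees $\le d$; and it is $d$-smallish if it admits an (exhaustive and separated, $\mathbb{Z}$-indexed) filtration whose associated graded module is $d$-small. Let $T$ be a tree and let $\underline{e}=(e_1,\dots,e_r)$ be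 directed edges of $T$ whose underlying edges are pairwise distinct. For $\underline{m}\in\mathbb{N}^r$ let $T(\underline{e},\underline{m})$ be the tree obtained from $T$ by replacing each $e_i$ by a directed path with $m_i$ edges (contracting $e_i$ if $m_i=0$). Theorem. Let $d\ge 0$. (1) If $M$ is a $d$-smallish $\mathcal{T}^{\mathrm{op}}$-module, then there is a polynomial $f_{M,T,\underline{e}}(t_1,\dots,t_r)$ with rational coefficients, of total degree at most $d$, such that, whenever $\underline{m}$ is sufficiently large in every coordinate, $M(T(\underline{e},\underline{m}))$ is finite dimensional and $$\dim_k M(T(\underline{e},\underline{m})) = f_{M,T,\underline{e}}(m_1,\dots,m_r).$$ (2) The same holds for a $d$-smallish $\mathcal{RT}^{\mathrm{op}}$-module $M$ and a rooted tree $(T,v)$, where $T(\underline{e},\underline{m})$ is rooted at the vertex coming from $v$. (3) The same holds for a $d$-smallish $\mathcal{T}_l^{\mathrm{op}}$-module $M$ with $l\ge 2$, if $T$ has at most $l$ leaves (and then $T(\underline{e},\underline{m})$ has at most $l$ leaves for all such $\underline{m}$). -/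

import Mathlib

open CategoryTheory CategoryTheory.Limits

universe v u

namespace TreeModules

/-! ### Modules over a category -/

section Modules

variable {k : Type u} [Field k] {C : Type v} [Category.{0} C]

/-- The principal projective module `P_x`: `P_x(y)` is the free `k`-module on `Hom(x, y)`,
and morphisms act by composition. -/
noncomputable def principalProjective (k : Type u) [Field k] (x : C) : C ⥤ ModuleCat.{u} k where
  obj y := ModuleCat.of k ((x ⟶ y) →₀ k)
  map f := ModuleCat.ofHom (Finsupp.lmapDomain k k (fun g => g ≫ f))
  map_id y := by
    ext : 1
    simp only [Category.comp_id]
    exact Finsupp.lmapDomain_id k k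
  map_comp f g := by
    ext : 1
    simp only [← Category.assoc]
    exact Finsupp.lmapDomain_comp k k (fun h => h ≫ f) (fun h => h ≫ g)

/-- `M` is generated in degrees at most `d` (with respect to a degree function on objects): it is
a quotient of a finite direct sum of principal projectives at objects of degree at most `d`. -/
def GeneratedInDegreeLE (deg : C → ℕ) (d : ℕ) (M : C ⥤ ModuleCat.{u} k) : Prop :=
  ∃ (n : ℕ) (x : Fin n → C), (∀ i, deg (x i) ≤ d) ∧
    ∃ p : (∐ fun i => principalProjective k (x i)) ⟶ M, Epi p

/-- `M` is `d`-small: it is a quotient of a submodule of a module generated in degrees at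
most `d`. -/
def IsSmall (deg : C → ℕ) (d : ℕ) (M : C ⥤ ModuleCat.{u} k) : Prop :=
  ∃ N : C ⥤ ModuleCat.{u} k, GeneratedInDegreeLE deg d N ∧
    ∃ (S : C ⥤ ModuleCat.{u} k) (i : S ⟶ N) (p : S ⟶ M), Mono i ∧ Epi p

/-- An increasing, exhaustive and separated `ℤ`-indexed filtration of `M` by submodules. A finite
filtration is one that is `⊥` for small indices and `⊤` for large ones. -/
structure Filtration (M : C ⥤ ModuleCat.{u} k) where
  /-- The pieces of the filtration. -/
  piece : ℤ → ∀ x : C, Submodule k (M.obj x)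
  mono : ∀ x : C, Monotone fun i => piece i x
  map_mem : ∀ (i : ℤ) {x y : C} (f : x ⟶ y) (a : M.obj x),
    a ∈ piece i x → (M.map f).hom a ∈ piece i y
  exhaustive : ∀ x : C, ⨆ i, piece i x = ⊤
  separated : ∀ x : C, ⨅ i, piece i x = ⊥

namespace Filtration

variable {M : C ⥤ ModuleCat.{u} k} (F : Filtration M)

/-- The value `F_i(x) / F_{i-1}(x)` of the `i`-th graded piece. -/
abbrev GrPiece (i : ℤ) (x : C) : Type u :=
  (F.piece i x) ⧸ (F.piece (i - 1) x).submoduleOf (F.piece i x)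

/-- The action of a morphism on the `i`-th graded piece, induced by that on `M`. -/
def grPieceMap (i : ℤ) {x y : C} (f : x ⟶ y) : F.GrPiece i x →ₗ[k] F.GrPiece i y :=
  Submodule.mapQ _ _ ((M.map f).hom.restrict (F.map_mem i f))
    (fun a ha => F.map_mem (i - 1) f a ha)

/-- The associated graded module `⨁ i, F_i / F_{i-1}`. -/
noncomputable def gr : C ⥤ ModuleCat.{u} k where
  obj x := ModuleCat.of k (DirectSum ℤ fun i => F.GrPiece i x)
  map f := ModuleCat.ofHom (DirectSum.lmap fun i => F.grPieceMap i f)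
  map_id x := by
    ext : 1
    refine DirectSum.linearMap_ext k fun i => ?_
    refine LinearMap.ext fun a => ?_
    obtain ⟨a, rfl⟩ := Submodule.Quotient.mk_surjective _ a
    simp [grPieceMap, DirectSum.lmap_lof, LinearMap.restrict_apply]
  map_comp f g := by
    ext : 1
    refine DirectSum.linearMap_ext k fun i => ?_
    refine LinearMap.ext fun a => ?_
    obtain ⟨a, rfl⟩ := Submodule.Quotient.mk_surjective _ a
    simp only [ModuleCat.hom_ofHom, ModuleCat.hom_comp, LinearMap.comp_apply,
      DirectSum.lmap_lof]
    congr 1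
    refine congrArg (Submodule.Quotient.mk (p := (F.piece (i - 1) _).submoduleOf
      (F.piece i _))) (Subtype.ext ?_)
    simp [LinearMap.restrict_apply]

end Filtration

/-- `M` is `d`-smallish: it admits a filtration whose associated graded module is `d`-small. -/
def IsSmallish (deg : C → ℕ) (d : ℕ) (M : C ⥤ ModuleCat.{u} k) : Prop :=
  ∃ F : Filtration M, IsSmall deg d F.gr

end Modules

/-! ### Trees and contractions -/

/-- A cut of a tree along one of its edges. -/
theorem exists_cut {V : Type} {G : SimpleGraph V} (hG : G.IsTree) {a b : V} (h : G.Adj a b) :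
    ∃ χ : V → Prop, χ a ∧ ¬ χ b ∧ ∀ u v, G.Adj u v → χ u → ¬ χ v → u = a ∧ v = b := by
  have hb := SimpleGraph.isAcyclic_iff_forall_adj_isBridge.1 hG.isAcyclic h
  rw [SimpleGraph.isBridge_iff] at hb
  refine ⟨fun x => (G \ SimpleGraph.fromEdgeSet {s(a, b)}).Reachable a x,
    SimpleGraph.Reachable.refl _, hb, ?_⟩
  intro u v huv hu hv
  by_contra hne
  apply hv
  by_cases hs : s(u, v) = s(a, b)
  · rw [Sym2.eq_iff] at hs
    rcases hs with hs | hs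
    · exact absurd hs hne
    · rw [hs.2]
  · refine hu.trans (SimpleGraph.Adj.reachable ?_)
    rw [SimpleGraph.sdiff_adj]
    refine ⟨huv, ?_⟩
    rw [SimpleGraph.fromEdgeSet_adj]
    rintro ⟨h1, -⟩
    exact hs (by simpa using h1)

/-- A finite tree. -/
structure FinTree : Type 1 where
  /-- The vertices. -/
  V : Type
  [fin : Finite V]
  /-- The underlying graph. -/
  graph : SimpleGraph V
  isTree : graph.IsTree

attribute [instance] FinTree.fin

namespace FinTree

/-- The number `|T|` of edges. -/
noncomputable def numEdges (T : FinTree) : ℕ := T.graph.edgeSet.ncard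

/-- The number of leaves, that is, of vertices with exactly one neighbour. -/
noncomputable def numLeaves (T : FinTree) : ℕ :=
  {x : T.V | (T.graph.neighborSet x).ncard = 1}.ncard

/-- A contraction of trees: a map on vertices that takes each edge to an edge or to a vertex and
whose fibers are (nonempty and) connected. -/
@[ext]
structure Contraction (S T : FinTree) : Type where
  /-- The map on vertices. -/
  toFun : S.V → T.V
  map_adj : ∀ x y, S.graph.Adj x y → toFun x = toFun y ∨ T.graph.Adj (toFun x) (toFun y)
  connected_fiber : ∀ w, (S.graph.induce (toFun ⁻¹' {w})).Connected

namespace Contraction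

variable {S T U : FinTree}

theorem surjective (f : Contraction S T) : Function.Surjective f.toFun := fun w => by
  obtain ⟨x⟩ := (f.connected_fiber w).nonempty
  exact ⟨x.1, x.2⟩

theorem exists_adj (f : Contraction S T) {a b : T.V} (h : T.graph.Adj a b) :
    ∃ x y, S.graph.Adj x y ∧ f.toFun x = a ∧ f.toFun y = b := by
  obtain ⟨χ, ha, hb, hχ⟩ := exists_cut T.isTree h
  obtain ⟨x0, hx0⟩ := f.surjective a
  obtain ⟨y0, hy0⟩ := f.surjective b
  by_contra hno
  have key : ∀ x y, S.graph.Reachable x y → χ (f.toFun x) → χ (f.toFun y) := by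
    rintro x y ⟨w⟩
    induction w with
    | nil => exact id
    | @cons p q s hpq _ ih =>
      intro hp
      apply ih
      by_contra hq
      rcases f.map_adj p q hpq with h1 | h1
      · exact hq (h1 ▸ hp)
      · obtain ⟨e1, e2⟩ := hχ _ _ h1 hp hq
        exact hno ⟨p, q, hpq, e1, e2⟩
  exact hb (hy0 ▸ key x0 y0 (S.isTree.connected x0 y0) (hx0.symm ▸ ha))

theorem connected_preimage (f : Contraction S T) (A : Set T.V)
    (hA : (T.graph.induce A).Connected) : (S.graph.induce (f.toFun ⁻¹' A)).Connected := by
  have fib : ∀ (x y : S.V) (hx : f.toFun x ∈ A) (hy : f.toFun y ∈ A), f.toFun x = f.toFun y →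
      (S.graph.induce (f.toFun ⁻¹' A)).Reachable ⟨x, hx⟩ ⟨y, hy⟩ := by
    intro x y hx hy hxy
    have h := (f.connected_fiber (f.toFun y)).preconnected ⟨x, hxy⟩ ⟨y, rfl⟩
    have hle : f.toFun ⁻¹' {f.toFun y} ⊆ f.toFun ⁻¹' A := by
      intro z hz
      have hz' : f.toFun z = f.toFun y := hz
      change f.toFun z ∈ A
      rw [hz']
      exact hy
    exact h.map (SimpleGraph.induceHomOfLE S.graph hle).toHom
  have key : ∀ a b : A, (T.graph.induce A).Reachable a b →
      ∀ (x y : S.V) (hx : f.toFun x = a.1) (hy : f.toFun y = b.1),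
      (S.graph.induce (f.toFun ⁻¹' A)).Reachable
        ⟨x, show f.toFun x ∈ A from hx ▸ a.2⟩ ⟨y, show f.toFun y ∈ A from hy ▸ b.2⟩ := by
    rintro a b ⟨w⟩
    induction w with
    | nil => intro x y hx hy; exact fib _ _ _ _ (hx.trans hy.symm)
    | @cons p q s hpq _ ih =>
      intro x y hx hy
      obtain ⟨x', y', hxy', e1, e2⟩ := f.exists_adj (a := p.1) (b := q.1) hpq
      have hx' : f.toFun x' ∈ A := e1 ▸ p.2
      have hy' : f.toFun y' ∈ A := e2 ▸ q.2
      refine (fib x x' _ hx' (hx.trans e1.symm)).trans (SimpleGraph.Reachable.trans ?_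
        (ih y' y e2 hy))
      exact SimpleGraph.Adj.reachable (by simpa using hxy')
  have hne : Nonempty (f.toFun ⁻¹' A) := by
    obtain ⟨a⟩ := hA.nonempty
    obtain ⟨x, hx⟩ := f.surjective a.1
    exact ⟨⟨x, show f.toFun x ∈ A from hx ▸ a.2⟩⟩
  refine @SimpleGraph.Connected.mk _ _ ?_ hne
  rintro ⟨x, hx⟩ ⟨y, hy⟩
  exact key ⟨f.toFun x, hx⟩ ⟨f.toFun y, hy⟩ (hA.preconnected _ _) x y rfl rfl

/-- The identity contraction. -/
def id (T : FinTree) : Contraction T T where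
  toFun x := x
  map_adj _ _ h := Or.inr h
  connected_fiber w := by
    have : Nonempty ((fun x : T.V => x) ⁻¹' {w}) := ⟨⟨w, rfl⟩⟩
    refine SimpleGraph.Connected.mk ?_
    rintro ⟨x, hx⟩ ⟨y, hy⟩
    have hx' : x = w := hx
    have hy' : y = w := hy
    subst hx' hy'
    exact SimpleGraph.Reachable.refl _

/-- Composition of contractions. -/
def comp (f : Contraction S T) (g : Contraction T U) : Contraction S U where
  toFun x := g.toFun (f.toFun x)
  map_adj x y h := by
    rcases f.map_adj x y h with h | h
    · exact Or.inl (congrArg g.toFun h)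
    · exact g.map_adj _ _ h
  connected_fiber w := f.connected_preimage _ (g.connected_fiber w)

end Contraction

/-- The category of trees with contractions. -/
instance : Category.{0} FinTree where
  Hom := Contraction
  id := Contraction.id
  comp := Contraction.comp

end FinTree

/-- A rooted tree: a tree with a chosen vertex. -/
structure RootedTree : Type 1 where
  /-- The underlying tree. -/
  tree : FinTree
  /-- The root. -/
  root : tree.V

/-- The category of rooted trees with root-preserving contractions. -/
instance : Category.{0} RootedTree where
  Hom S T := {f : FinTree.Contraction S.tree T.tree // f.toFun S.root = T.root}
  id T := ⟨FinTree.Contraction.id T.tree, rfl⟩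
  comp f g := ⟨f.1.comp g.1, (congrArg g.1.toFun f.2).trans g.2⟩

/-- The full subcategory of the category of trees on the trees with at most `l` leaves. -/
abbrev BoundedTree (l : ℕ) : Type 1 :=
  ObjectProperty.FullSubcategory fun T : FinTree => T.numLeaves ≤ l

/-! ### Smallish modules over the opposites of the three categories of trees -/

/-- `d`-smallish modules over the opposite of the category of trees. -/
def IsSmallishTree {k : Type u} [Field k] (d : ℕ) (M : FinTreeᵒᵖ ⥤ ModuleCat.{u} k) : Prop :=
  IsSmallish (fun T => T.unop.numEdges) d M

/-- `d`-smallish modules over the opposite of the category of rooted trees. -/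
def IsSmallishRooted {k : Type u} [Field k] (d : ℕ) (M : RootedTreeᵒᵖ ⥤ ModuleCat.{u} k) : Prop :=
  IsSmallish (fun T => T.unop.tree.numEdges) d M

/-- `d`-smallish modules over the opposite of the category of trees with at most `l` leaves. -/
def IsSmallishBounded {k : Type u} [Field k] {l : ℕ} (d : ℕ)
    (M : (BoundedTree l)ᵒᵖ ⥤ ModuleCat.{u} k) : Prop :=
  IsSmallish (fun T => T.unop.obj.numEdges) d M

/-! ### Subdivision -/

namespace FinTree

variable (T : FinTree) {r : ℕ} (e : Fin r → T.graph.Dart) (m : Fin r → ℕ)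

/-- The vertices of `T` together with the vertices `0, …, m i` of one path for each `i`. -/
abbrev PreVertex : Type := T.V ⊕ (Σ i : Fin r, Fin (m i + 1))

/-- The gluing: the first and last vertices of the `i`-th path are identified with the source and
target of the directed edge `e i` (so that the two get identified when `m i = 0`). -/
inductive Glue : T.PreVertex m → T.PreVertex m → Prop
  | source (i : Fin r) : Glue (Sum.inl (e i).fst) (Sum.inr ⟨i, 0⟩)
  | target (i : Fin r) : Glue (Sum.inl (e i).snd) (Sum.inr ⟨i, Fin.last (m i)⟩)

/-- The vertices of the subdivided tree. -/
abbrev SubdivVertex : Type := Quot (T.Glue e m)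

/-- The edges of the subdivided tree: the edges of `T` other than the `e i`, and the edges of the
paths. -/
inductive SubdivEdge : T.SubdivVertex e m → T.SubdivVertex e m → Prop
  | old (x y : T.V) : T.graph.Adj x y → (∀ i, (e i).edge ≠ s(x, y)) →
      SubdivEdge (Quot.mk _ (Sum.inl x)) (Quot.mk _ (Sum.inl y))
  | path (i : Fin r) (t : Fin (m i)) :
      SubdivEdge (Quot.mk _ (Sum.inr ⟨i, t.castSucc⟩)) (Quot.mk _ (Sum.inr ⟨i, t.succ⟩))

/-- The graph obtained from `T` by replacing each directed edge `e i` by a path with `m i`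
edges. -/
def subdivGraph : SimpleGraph (T.SubdivVertex e m) := SimpleGraph.fromRel (T.SubdivEdge e m)

variable {T e m}

theorem SubdivEdge.reachable {a b : T.SubdivVertex e m} (h : T.SubdivEdge e m a b) :
    (T.subdivGraph e m).Reachable a b := by
  by_cases hab : a = b
  · rw [hab]
  · exact SimpleGraph.Adj.reachable ⟨hab, Or.inl h⟩

theorem subdivGraph_reachable_path (i : Fin r) (t : Fin (m i + 1)) :
    (T.subdivGraph e m).Reachable (Quot.mk _ (Sum.inl (e i).fst))
      (Quot.mk _ (Sum.inr ⟨i, t⟩)) := by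
  induction t using Fin.induction with
  | zero => rw [Quot.sound (Glue.source i)]
  | succ t ih => exact ih.trans (SubdivEdge.path i t).reachable

theorem subdivGraph_reachable_old {x y : T.V} (h : T.graph.Adj x y) :
    (T.subdivGraph e m).Reachable (Quot.mk _ (Sum.inl x)) (Quot.mk _ (Sum.inl y)) := by
  by_cases hi : ∀ i, (e i).edge ≠ s(x, y)
  · exact (SubdivEdge.old x y h hi).reachable
  · push Not at hi
    obtain ⟨i, hi⟩ := hi
    have hr : (T.subdivGraph e m).Reachable (Quot.mk _ (Sum.inl (e i).fst))
        (Quot.mk _ (Sum.inl (e i).snd)) := by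
      rw [Quot.sound (Glue.target i)]
      exact subdivGraph_reachable_path i _
    have hi' : s((e i).fst, (e i).snd) = s(x, y) := hi
    rw [Sym2.eq_iff] at hi'
    rcases hi' with ⟨rfl, rfl⟩ | ⟨rfl, rfl⟩
    · exact hr
    · exact hr.symm

theorem subdivGraph_connected : (T.subdivGraph e m).Connected := by
  have hold : ∀ x y : T.V, (T.subdivGraph e m).Reachable (Quot.mk _ (Sum.inl x))
      (Quot.mk _ (Sum.inl y)) := by
    intro x y
    obtain ⟨w⟩ := T.isTree.connected x y
    induction w with
    | nil => exact SimpleGraph.Reachable.refl _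
    | cons h _ ih => exact (subdivGraph_reachable_old h).trans ih
  obtain ⟨x0⟩ := T.isTree.connected.nonempty
  have hall : ∀ a : T.SubdivVertex e m,
      (T.subdivGraph e m).Reachable (Quot.mk _ (Sum.inl x0)) a := by
    intro a
    induction a using Quot.ind with
    | mk p =>
      rcases p with x | ⟨i, t⟩
      · exact hold _ _
      · exact (hold _ _).trans (subdivGraph_reachable_path i t)
  have : Nonempty (T.SubdivVertex e m) := ⟨Quot.mk _ (Sum.inl x0)⟩
  exact SimpleGraph.Connected.mk fun a b => (hall a).symm.trans (hall b)

/-- A graph all of whose edges can be cut off by a two-colouring is acyclic. -/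
theorem isAcyclic_of_cuts {W : Type} {R : W → W → Prop}
    (h : ∀ a b, R a b → a ≠ b → ∃ χ : W → Prop, ¬ (χ a ↔ χ b) ∧
      ∀ c d, R c d → ¬ (χ c ↔ χ d) → s(c, d) = s(a, b)) :
    (SimpleGraph.fromRel R).IsAcyclic := by
  rw [SimpleGraph.isAcyclic_iff_forall_adj_isBridge]
  have main : ∀ a b, R a b → a ≠ b → (SimpleGraph.fromRel R).IsBridge s(a, b) := by
    intro a b hab hne
    obtain ⟨χ, h1, h2⟩ := h a b hab hne
    rw [SimpleGraph.isBridge_iff]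
    rintro ⟨w⟩
    have key : ∀ c d, (SimpleGraph.fromRel R \ SimpleGraph.fromEdgeSet {s(a, b)}).Walk c d →
        (χ c ↔ χ d) := by
      intro c d w
      induction w with
      | nil => exact Iff.rfl
      | @cons p q s hpq _ ih =>
        refine Iff.trans ?_ ih
        by_contra hc
        rw [SimpleGraph.sdiff_adj, SimpleGraph.fromRel_adj, SimpleGraph.fromEdgeSet_adj] at hpq
        obtain ⟨⟨hne', h3⟩, h4⟩ := hpq
        apply h4
        refine ⟨?_, hne'⟩
        rcases h3 with h3 | h3
        · exact h2 p q h3 hc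
        · have := h2 q p h3 (fun h => hc h.symm)
          rw [Sym2.eq_swap] at this
          exact this
    exact h1 (key a b w)
  intro a b hab
  rw [SimpleGraph.fromRel_adj] at hab
  rcases hab.2 with h' | h'
  · exact main a b h' hab.1
  · rw [Sym2.eq_swap]
    exact main b a h' hab.1.symm

theorem subdivGraph_isAcyclic (he : Function.Injective fun i => (e i).edge) :
    (T.subdivGraph e m).IsAcyclic := by
  refine isAcyclic_of_cuts ?_
  intro a b hab hne
  cases hab with
  | old x y hxy hi =>
    obtain ⟨χ, hx, hy, hχ⟩ := exists_cut T.isTree hxy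
    have hloc : ∀ i, χ (e i).fst ↔ χ (e i).snd := by
      intro i
      constructor
      · intro h1
        by_contra h2
        obtain ⟨e1, e2⟩ := hχ _ _ (e i).adj h1 h2
        exact hi i (by rw [← e1, ← e2]; rfl)
      · intro h1
        by_contra h2
        obtain ⟨e1, e2⟩ := hχ _ _ (e i).adj.symm h1 h2
        exact hi i (by rw [← e1, ← e2, Sym2.eq_swap]; rfl)
    refine ⟨Quot.lift (Sum.elim χ fun p => χ (e p.1).fst) ?_, fun h => hy (h.1 hx), ?_⟩
    · intro p q hpq
      cases hpq with
      | source i => rfl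
      | target i => exact propext (hloc i).symm
    · intro c d hcd hc
      cases hcd with
      | old u v huv _ =>
        change ¬ (χ u ↔ χ v) at hc
        by_cases hu : χ u
        · have hv : ¬ χ v := fun hv => hc ⟨fun _ => hv, fun _ => hu⟩
          obtain ⟨rfl, rfl⟩ := hχ u v huv hu hv
          rfl
        · have hv : χ v := by
            by_contra hv
            exact hc ⟨fun h => absurd h hu, fun h => absurd h hv⟩
          obtain ⟨rfl, rfl⟩ := hχ v u huv.symm hv hu
          exact Sym2.eq_swap
      | path i t => exact absurd Iff.rfl hc
  | path i t =>
    obtain ⟨χ, hx, hy, hχ⟩ := exists_cut T.isTree (e i).adj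
    have hloc : ∀ x y, T.graph.Adj x y → s(x, y) ≠ (e i).edge → (χ x ↔ χ y) := by
      intro x y hxy hn
      constructor
      · intro h1
        by_contra h2
        obtain ⟨e1, e2⟩ := hχ _ _ hxy h1 h2
        exact hn (by rw [e1, e2]; rfl)
      · intro h1
        by_contra h2
        obtain ⟨e1, e2⟩ := hχ _ _ hxy.symm h1 h2
        exact hn (by rw [e1, e2, Sym2.eq_swap]; rfl)
    refine ⟨Quot.lift (Sum.elim χ fun p =>
      (p.1 = i ∧ (p.2 : ℕ) ≤ t) ∨ (p.1 ≠ i ∧ χ (e p.1).fst)) ?_, ?_, ?_⟩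
    · intro p q hpq
      cases hpq with
      | source j =>
        by_cases hj : j = i
        · subst hj; simp [hx]
        · simp [hj]
      | target j =>
        by_cases hj : j = i
        · subst hj; simp [hy]
        · have := hloc _ _ (e j).adj (fun h => hj (he h))
          simp [hj, this]
    · simp
    · intro c d hcd hc
      cases hcd with
      | old u v huv hn => exact absurd (hloc u v huv fun h => hn i h.symm) hc
      | path j s =>
        by_cases hj : j = i
        · subst hj
          have hst : s = t := by
            simp only [Sum.elim_inr, true_and, ne_eq, not_true_eq_false,
              false_and, or_false, Fin.val_castSucc, Fin.val_succ] at hc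
            ext
            omega
          rw [hst]
        · exact absurd (by simp [hj]) hc

variable (T e m)

/-- The tree `T(e, m)` obtained from `T` by subdividing each of the directed edges `e i` (whose
underlying edges are distinct) into `m i` edges; subdividing into `0` edges means contracting. -/
def subdivide (he : Function.Injective fun i => (e i).edge) (m : Fin r → ℕ) : FinTree where
  V := T.SubdivVertex e m
  graph := T.subdivGraph e m
  isTree := ⟨subdivGraph_connected, subdivGraph_isAcyclic he⟩

/-- The vertex of `T(e, m)` that comes from a vertex of `T`. -/
def subdivideVertex (he : Function.Injective fun i => (e i).edge) (m : Fin r → ℕ) (x : T.V) :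
    (T.subdivide e he m).V :=
  Quot.mk _ (Sum.inl x)

end FinTree

end TreeModules

/-!
The proof reduces the statement to counting lattice points of monomial ideals.

A smallish module has, at every object, the dimension of its associated graded module, because an
exhaustive and separated filtration with finite dimensional associated graded space is finite
(`finite_and_finrank_of_filtration`). A small module is at every object `y` a quotient `S y ⧸ K y`,
where `S` and `K` are subspaces of the free vector space on the morphisms from finitely many
objects `x j` of degree at most `d`, stable under all morphisms (`IsSmall.exists_subquotient`). So
it suffices to show that `dim (S (T(e, m)))` is eventually a polynomial in `m` of total degree at
most `d`, for every stable `S`.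

A contraction `T(e, m) → U` is recorded by the images of the vertices of `T` and, for every `i`, by
the word of the images of the `m i + 1` vertices of the `i`-th path. Contracting an edge of a path
in `T(e, m + δ i)` gives a contraction to `T(e, m)` (`FinTree.merge`), and composing with it
duplicates a letter of the `i`-th word. Duplication is strictly monotone for the lexicographic
order, so the leading terms of the elements of `S` form a set of words closed under duplication, and
`dim (S (T(e, m)))` is the number of its elements with word lengths `m i + 1`
(`eventuallyPolynomial_finrank`). No Noetherianity of the categories of trees is needed.

Distinct edges that are not contracted have distinct images (`FinTree.Contraction.edge_injective`),
so the words change their letters at most `d` times in total. Hence, after removing repetitions,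
only finitely many tuples of words occur. For a fixed one with `q i` changes in the `i`-th word,
the lengths of the runs of equal letters identify the tuples that reduce to it with the lattice
points of a product of blocks of sizes `q i + 1`, and a set closed under duplication with an upper
set. By Dickson's lemma and inclusion-exclusion, the number of points of an upper set with given
block sums is eventually a polynomial of degree at most `∑ q i ≤ d`
(`IsUpperSet.eventuallyPolynomial_slice`).

The three categories of trees are treated together through the structure `WordModel`. For trees
with a bounded number of leaves only the `m` with all `m i ≥ 1` are used: for these `T(e, m)` has at
most as many leaves as `T` (`FinTree.numLeaves_subdivide_le`).
-/

namespace TreeModules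

/-! ### Eventually polynomial functions and lattice points of upper sets -/

/-- `φ` agrees with a polynomial of total degree at most `d` at all points whose coordinates are
all sufficiently large. -/
def EventuallyPolynomial {r : ℕ} (d : ℕ) (φ : (Fin r → ℕ) → ℚ) : Prop :=
  ∃ f : MvPolynomial (Fin r) ℚ, f.totalDegree ≤ d ∧
    ∃ N : ℕ, ∀ m : Fin r → ℕ, (∀ i, N ≤ m i) → φ m = MvPolynomial.eval (fun i => (m i : ℚ)) f

namespace EventuallyPolynomial

variable {r d : ℕ} {φ ψ : (Fin r → ℕ) → ℚ}

theorem mono {d' : ℕ} (h : EventuallyPolynomial d φ) (hd : d ≤ d') :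
    EventuallyPolynomial d' φ := by
  obtain ⟨f, hf, N, hN⟩ := h
  exact ⟨f, hf.trans hd, N, hN⟩

theorem zero : EventuallyPolynomial d (fun _ : Fin r → ℕ => (0 : ℚ)) :=
  ⟨0, by simp, 0, by simp⟩

theorem add (h : EventuallyPolynomial d φ) (h' : EventuallyPolynomial d ψ) :
    EventuallyPolynomial d (fun m => φ m + ψ m) := by
  obtain ⟨f, hf, N, hN⟩ := h
  obtain ⟨g, hg, N', hN'⟩ := h'
  refine ⟨f + g, (MvPolynomial.totalDegree_add _ _).trans (max_le hf hg), max N N', ?_⟩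
  intro m hm
  change φ m + ψ m = _
  rw [map_add, hN m fun i => (le_max_left _ _).trans (hm i),
    hN' m fun i => (le_max_right _ _).trans (hm i)]

theorem sub (h : EventuallyPolynomial d φ) (h' : EventuallyPolynomial d ψ) :
    EventuallyPolynomial d (fun m => φ m - ψ m) := by
  obtain ⟨f, hf, N, hN⟩ := h
  obtain ⟨g, hg, N', hN'⟩ := h'
  refine ⟨f - g, (MvPolynomial.totalDegree_sub _ _).trans (max_le hf hg), max N N', ?_⟩
  intro m hm
  change φ m - ψ m = _
  rw [map_sub, hN m fun i => (le_max_left _ _).trans (hm i),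
    hN' m fun i => (le_max_right _ _).trans (hm i)]

theorem sum {ι : Type*} (s : Finset ι) {φ : ι → (Fin r → ℕ) → ℚ}
    (h : ∀ i ∈ s, EventuallyPolynomial d (φ i)) :
    EventuallyPolynomial d (fun m => ∑ i ∈ s, φ i m) := by
  classical
  induction s using Finset.induction_on with
  | empty => simpa using zero
  | insert a s ha ih =>
    simp only [Finset.sum_insert ha]
    exact (h a (by simp)).add (ih fun i hi => h i (by simp [hi]))

theorem congr (N : ℕ) (h : EventuallyPolynomial d φ)
    (hN : ∀ m : Fin r → ℕ, (∀ i, N ≤ m i) → ψ m = φ m) : EventuallyPolynomial d ψ := by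
  obtain ⟨f, hf, N', hN'⟩ := h
  refine ⟨f, hf, max N N', fun m hm => ?_⟩
  rw [hN m fun i => (le_max_left _ _).trans (hm i),
    hN' m fun i => (le_max_right _ _).trans (hm i)]

theorem prod_univariate (n : Fin r → ℕ) (P : Fin r → Polynomial ℚ)
    (hP : ∀ i, (P i).natDegree ≤ n i) :
    EventuallyPolynomial (∑ i, n i) (fun m => ∏ i, (P i).eval (m i : ℚ)) := by
  refine ⟨∏ i, Polynomial.aeval (MvPolynomial.X i) (P i), ?_, 0, ?_⟩
  · refine (MvPolynomial.totalDegree_finsetProd _ _).trans (Finset.sum_le_sum fun i _ => ?_)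
    rw [Polynomial.aeval_eq_sum_range]
    refine MvPolynomial.totalDegree_finsetSum_le fun j hj => ?_
    refine (MvPolynomial.totalDegree_smul_le _ _).trans ?_
    rw [MvPolynomial.totalDegree_X_pow]
    exact (Finset.mem_range_succ_iff.1 hj).trans (hP i)
  · intro m _
    rw [map_prod]
    refine Finset.prod_congr rfl fun i _ => ?_
    rw [Polynomial.aeval_def, Polynomial.eval₂_eq_sum_range, Polynomial.eval_eq_sum_range, map_sum]
    simp

end EventuallyPolynomial

theorem card_sum_eq_choose (q n : ℕ) :
    Nat.card {b : Fin (q + 1) → ℕ // ∑ j, b j = n} = (n + q).choose q := by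
  rw [← Nat.card_congr (Sym.equivNatSumOfFintype (Fin (q + 1)) n), Nat.card_eq_fintype_card,
    Sym.card_sym_eq_choose, Fintype.card_fin, show q + 1 + n - 1 = n + q by omega,
    Nat.choose_symm_add]

section Slices

variable {r : ℕ} {ℓ : Fin r → ℕ}

/-- The lattice points whose `i`-th block of coordinates has sum `m i - s i`. -/
def slice (s : Fin r → ℕ) (m : Fin r → ℕ) : Set (∀ i, Fin (ℓ i) → ℕ) :=
  {a | ∀ i, s i + ∑ j, a i j = m i}

theorem slice_finite (s m : Fin r → ℕ) : (slice (ℓ := ℓ) s m).Finite := by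
  refine Set.Finite.subset (Set.finite_Iic (fun i _ => m i)) fun a ha i j => ?_
  have h1 := ha i
  have h2 : a i j ≤ ∑ j, a i j :=
    Finset.single_le_sum (fun _ _ => Nat.zero_le _) (Finset.mem_univ j)
  simp only
  omega

/-- Translating by `g` and counting each block by stars and bars. -/
theorem card_slice_Ici (q : Fin r → ℕ) (hq : ∀ i, ℓ i = q i + 1) (s m : Fin r → ℕ)
    (g : ∀ i, Fin (ℓ i) → ℕ) (hm : ∀ i, s i + ∑ j, g i j ≤ m i) :
    (Set.Ici g ∩ slice s m).ncard =
      ∏ i, (m i - (s i + ∑ j, g i j) + q i).choose (q i) := by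
  obtain rfl : ℓ = fun i => q i + 1 := funext hq
  have e : {a // a ∈ Set.Ici g ∩ slice s m} ≃
      ∀ i, {b : Fin (q i + 1) → ℕ // ∑ j, b j = m i - (s i + ∑ j, g i j)} :=
    { toFun := fun a i => ⟨fun j => a.1 i j - g i j, by
        have h1 := a.2.2 i
        have h2 : ∑ j, (a.1 i j - g i j) + ∑ j, g i j = ∑ j, a.1 i j := by
          rw [← Finset.sum_add_distrib]
          exact Finset.sum_congr rfl fun j _ => Nat.sub_add_cancel (a.2.1 i j)
        have h3 := hm i
        change ∑ j, (a.1 i j - g i j) = _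
        omega⟩
      invFun := fun b => ⟨fun i j => (b i).1 j + g i j, fun i j => Nat.le_add_left _ _, fun i => by
        have h1 : ∑ j, (b i).1 j = m i - (s i + ∑ j : Fin (q i + 1), g i j) := (b i).2
        have h3 : s i + ∑ j : Fin (q i + 1), g i j ≤ m i := hm i
        change s i + ∑ j, ((b i).1 j + g i j) = m i
        rw [Finset.sum_add_distrib]
        omega⟩
      left_inv := fun a => by
        ext i j
        exact Nat.sub_add_cancel (a.2.1 i j)
      right_inv := fun b => by
        ext i j
        simp }
  rw [← Nat.card_coe_set_eq, Nat.card_congr e, Nat.card_pi]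
  exact Finset.prod_congr rfl fun i _ => card_sum_eq_choose _ _

theorem eventuallyPolynomial_slice_Ici (q : Fin r → ℕ) (hq : ∀ i, ℓ i = q i + 1) (s : Fin r → ℕ)
    (g : ∀ i, Fin (ℓ i) → ℕ) :
    EventuallyPolynomial (∑ i, q i) fun m => ((Set.Ici g ∩ slice s m).ncard : ℚ) := by
  refine (EventuallyPolynomial.prod_univariate q
    (fun i => Polynomial.preHilbertPoly ℚ (q i) (s i + ∑ j, g i j))
    fun i => (Polynomial.natDegree_preHilbertPoly ℚ _ _).le).congr
      (∑ i, (s i + ∑ j, g i j)) fun m hm => ?_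
  have hm' : ∀ i, s i + ∑ j, g i j ≤ m i := fun i =>
    (Finset.single_le_sum (f := fun i => s i + ∑ j, g i j) (fun _ _ => Nat.zero_le _)
      (Finset.mem_univ i)).trans (hm i)
  rw [card_slice_Ici q hq s m g hm', Nat.cast_prod]
  exact Finset.prod_congr rfl fun i _ =>
    (Polynomial.preHilbertPoly_eq_choose_sub_add ℚ (q i) (hm' i)).symm

/-- Inclusion-exclusion: the intersection of two principal upper sets is again principal. -/
theorem eventuallyPolynomial_slice_upperClosure (q : Fin r → ℕ) (hq : ∀ i, ℓ i = q i + 1)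
    (s : Fin r → ℕ) (n : ℕ) : ∀ l : List (∀ i, Fin (ℓ i) → ℕ), l.length = n →
    EventuallyPolynomial (∑ i, q i) fun m => (({a | ∃ g ∈ l, g ≤ a} ∩ slice s m).ncard : ℚ) := by
  induction n with
  | zero =>
    intro l hl
    obtain rfl := List.length_eq_zero_iff.1 hl
    simpa using EventuallyPolynomial.zero
  | succ n ih =>
    intro l hl
    obtain ⟨g, l, rfl⟩ := List.exists_cons_of_length_eq_add_one hl
    have hl' : l.length = n := by simpa using hl
    refine (((eventuallyPolynomial_slice_Ici q hq s g).add (ih l hl')).sub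
      (ih (l.map (g ⊔ ·)) (by simpa using hl'))).congr 0 fun m _ => ?_
    have h1 : {a | ∃ g' ∈ g :: l, g' ≤ a} ∩ slice s m =
        (Set.Ici g ∩ slice s m) ∪ ({a | ∃ g' ∈ l, g' ≤ a} ∩ slice s m) := by
      rw [← Set.union_inter_distrib_right]
      congr 1
      ext a
      simp
    have h2 : {a | ∃ g' ∈ l.map (g ⊔ ·), g' ≤ a} ∩ slice s m =
        (Set.Ici g ∩ slice s m) ∩ ({a | ∃ g' ∈ l, g' ≤ a} ∩ slice s m) := by
      ext a
      simp only [List.mem_map, exists_exists_and_eq_and, sup_le_iff, Set.mem_inter_iff,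
        Set.mem_ofPred_eq, Set.mem_Ici]
      grind
    have h3 := Set.ncard_union_add_ncard_inter (Set.Ici g ∩ slice s m)
      ({a | ∃ g' ∈ l, g' ≤ a} ∩ slice s m) ((slice_finite s m).inter_of_right _)
      ((slice_finite s m).inter_of_right _)
    rw [h1, h2, eq_sub_iff_add_eq]
    exact_mod_cast h3

/-- The number of points of an upper set in a product of blocks of sizes `q i + 1` with prescribed
block sums: the multigraded Hilbert function of a monomial ideal. By Dickson's lemma the upper set
has finitely many minimal elements. -/
theorem IsUpperSet.eventuallyPolynomial_slice {U : Set (∀ i, Fin (ℓ i) → ℕ)} (hU : IsUpperSet U)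
    (q : Fin r → ℕ) (hq : ∀ i, ℓ i = q i + 1) (s : Fin r → ℕ) :
    EventuallyPolynomial (∑ i, q i) fun m => ((U ∩ slice s m).ncard : ℚ) := by
  have hfin : {a | Minimal (· ∈ U) a}.Finite :=
    WellQuasiOrderedLE.finite_of_isAntichain (setOfPred_minimal_antichain _)
  have hU' : U = {a | ∃ g ∈ hfin.toFinset.toList, g ≤ a} := by
    ext a
    simp only [Finset.mem_toList, Set.Finite.mem_toFinset, Set.mem_ofPred_eq]
    constructor
    · intro ha
      obtain ⟨g, h1, h2⟩ := exists_minimal_le_of_wellFoundedLT (· ∈ U) a ha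
      exact ⟨g, h2, h1⟩
    · rintro ⟨g, hg, hga⟩
      exact hU hga hg.prop
  rw [hU']
  exact eventuallyPolynomial_slice_upperClosure q hq s _ _ rfl

end Slices

/-! ### Words and the duplication of letters -/

section Words

variable {W : Type*}

/-- The word obtained from `c` by repeating its `j`-th letter `a j + 1` times. -/
def expand : (c : List W) → (Fin c.length → ℕ) → List W
  | [], _ => []
  | x :: c, a => List.replicate (a 0 + 1) x ++ expand c (fun j => a j.succ)

/-- The word obtained from `w` by duplicating the letter at position `p`. -/
def dup (p : ℕ) (w : List W) : List W := w.take (p + 1) ++ w.drop p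

/-- The number of positions at which a word changes its letter. -/
def changes [DecidableEq W] : List W → ℕ
  | x :: y :: l => (if x = y then 0 else 1) + changes (y :: l)
  | _ => 0

theorem length_expand (c : List W) (a : Fin c.length → ℕ) :
    (expand c a).length = c.length + ∑ j, a j := by
  induction c with
  | nil => simp [expand]
  | cons x c ih =>
    have h := Fin.sum_univ_succ (n := c.length) a
    simp only [expand, List.length_append, List.length_replicate, ih, List.length_cons] at h ⊢
    omega

theorem dup_add_append (u w : List W) (p : ℕ) : dup (u.length + p) (u ++ w) = u ++ dup p w := by
  simp [dup, List.take_append, List.drop_append, add_assoc,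
    List.take_of_length_le (show u.length ≤ u.length + (p + 1) by omega)]

/-- Lengthening one run of equal letters duplicates a letter of that run. -/
theorem exists_dup_expand (c : List W) (a : Fin c.length → ℕ) (j : Fin c.length) :
    ∃ p < (expand c a).length,
      expand c (Function.update a j (a j + 1)) = dup p (expand c a) := by
  induction c with
  | nil => exact j.elim0
  | cons x c ih =>
    refine Fin.cases ?_ (fun j => ?_) j
    · refine ⟨0, by simp [expand], ?_⟩
      have h : (fun k : Fin c.length => Function.update a 0 (a 0 + 1) k.succ) =
          fun k => a k.succ := by
        funext k
        exact Function.update_of_ne (Fin.succ_ne_zero k) _ _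
      simp only [expand, Function.update_self]
      rw [h]
      simp [dup, List.replicate_succ]
    · obtain ⟨p, hp, h⟩ := ih (fun k => a k.succ) j
      refine ⟨a 0 + 1 + p, ?_, ?_⟩
      · simp only [expand, List.length_append, List.length_replicate]
        omega
      · have h0 : Function.update a j.succ (a j.succ + 1) 0 = a 0 :=
          Function.update_of_ne (Fin.succ_ne_zero j).symm _ _
        have h1 : (fun k : Fin c.length => Function.update a j.succ (a j.succ + 1) k.succ) =
            Function.update (fun k : Fin c.length => a k.succ) j (a j.succ + 1) := by
          funext k
          by_cases hk : k = j
          · subst hk; simp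
          · rw [Function.update_of_ne hk, Function.update_of_ne (by simpa using hk)]
        simp only [expand]
        rw [h0, h1, h]
        have := dup_add_append (List.replicate (a 0 + 1) x) (expand c fun k => a k.succ) p
        rw [List.length_replicate] at this
        exact this.symm

theorem exists_expand_eq (w : List W) :
    ∃ (c : List W) (a : Fin c.length → ℕ), c.IsChain (· ≠ ·) ∧ expand c a = w := by
  induction w with
  | nil => exact ⟨[], fun j => j.elim0, List.IsChain.nil, rfl⟩
  | cons x w ih =>
    obtain ⟨c, a, hc, rfl⟩ := ih
    cases c with
    | nil => exact ⟨[x], fun _ => 0, List.IsChain.singleton x, by simp [expand]⟩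
    | cons y c =>
      by_cases hxy : x = y
      · subst hxy
        refine ⟨x :: c, Fin.cons (a 0 + 1) fun j => a j.succ, hc, ?_⟩
        simp [expand, List.replicate_succ]
      · refine ⟨x :: y :: c, Fin.cons 0 a, List.isChain_cons_cons.2 ⟨hxy, hc⟩, ?_⟩
        simp [expand]

theorem head?_expand (c : List W) (a : Fin c.length → ℕ) : (expand c a).head? = c.head? := by
  cases c <;> simp [expand, List.replicate_succ]

theorem replicate_append_inj {x : W} {u v : List W} (hu : u.head? ≠ some x)
    (hv : v.head? ≠ some x) {s t : ℕ} (h : List.replicate s x ++ u = List.replicate t x ++ v) :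
    s = t ∧ u = v := by
  induction s generalizing t with
  | zero =>
    cases t with
    | zero => simpa using h
    | succ t => exact absurd (by simpa [List.replicate_succ] using congrArg List.head? h) hu
  | succ s ih =>
    cases t with
    | zero => exact absurd (by simpa [List.replicate_succ] using congrArg List.head? h.symm) hv
    | succ t =>
      obtain ⟨h1, h2⟩ := ih (t := t) (by simpa [List.replicate_succ] using h)
      exact ⟨by rw [h1], h2⟩

theorem head?_ne_of_isChain {x : W} {c : List W} (h : (x :: c).IsChain (· ≠ ·)) :
    c.head? ≠ some x := by
  cases c with
  | nil => simp
  | cons y c =>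
    have := (List.isChain_cons_cons.1 h).1
    simpa using this.symm

/-- The run-length encoding of a word is unique. -/
theorem expand_injective {c c' : List W} (hc : c.IsChain (· ≠ ·)) (hc' : c'.IsChain (· ≠ ·))
    {a : Fin c.length → ℕ} {a' : Fin c'.length → ℕ} (h : expand c a = expand c' a') :
    (⟨c, a⟩ : Σ c : List W, Fin c.length → ℕ) = ⟨c', a'⟩ := by
  induction c generalizing c' with
  | nil =>
    cases c' with
    | nil => congr 1; funext j; exact j.elim0
    | cons x c' => simp [expand, List.replicate_succ] at h
  | cons x c ih =>
    cases c' with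
    | nil => simp [expand, List.replicate_succ] at h
    | cons x' c' =>
      have hx : x = x' := by
        have := congrArg List.head? h
        simpa [head?_expand] using this
      subst hx
      have h1 := head?_ne_of_isChain hc
      have h2 := head?_ne_of_isChain hc'
      rw [← head?_expand c fun j => a j.succ] at h1
      rw [← head?_expand c' fun j => a' j.succ] at h2
      obtain ⟨h3, h4⟩ := replicate_append_inj h1 h2 h
      obtain ⟨rfl, h6⟩ := Sigma.mk.inj (ih (c' := c') hc.tail hc'.tail h4)
      congr 1
      funext j
      refine Fin.cases ?_ (fun j => ?_) j
      · omega
      · exact congrFun (eq_of_heq h6) j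

theorem changes_replicate_append [DecidableEq W] (n : ℕ) (x : W) (w : List W) :
    changes (List.replicate n x ++ x :: w) = changes (x :: w) := by
  induction n with
  | zero => rfl
  | succ n ih =>
    rw [← ih]
    cases n <;> simp [List.replicate_succ, changes]

theorem changes_expand [DecidableEq W] (c : List W) (a : Fin c.length → ℕ)
    (hc : c.IsChain (· ≠ ·)) : changes (expand c a) = c.length - 1 := by
  induction c with
  | nil => rfl
  | cons x c ih =>
    have h : expand (x :: c) a = List.replicate (a 0) x ++ x :: expand c (fun j => a j.succ) := by
      simp [expand, List.replicate_succ']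
    rw [h, changes_replicate_append]
    cases c with
    | nil => rfl
    | cons y c =>
      have h1 := (List.isChain_cons_cons.1 hc).1
      have h2 := ih (fun j => a j.succ) hc.tail
      generalize hw : expand (y :: c) (fun j => a j.succ) = w at h2 ⊢
      have h3 := head?_expand (y :: c) (fun j => a j.succ)
      rw [hw] at h3
      cases w with
      | nil => simp at h3
      | cons z w =>
        obtain rfl : z = y := by simpa using h3
        simp only [List.length_cons] at h2 ⊢
        simp only [changes, h1, if_false]
        omega

theorem changes_map_range [DecidableEq W] (φ : ℕ → W) (n : ℕ) :
    changes ((List.range (n + 1)).map φ) =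
      ((Finset.range n).filter fun t => φ t ≠ φ (t + 1)).card := by
  induction n generalizing φ with
  | zero => rfl
  | succ n ih =>
    have h : ((List.range (n + 1 + 1)).map φ) =
        φ 0 :: φ 1 :: (List.range n).map (fun t => φ (t + 2)) := by
      rw [List.range_succ_eq_map, List.range_succ_eq_map]
      simp [Function.comp_def]
    have h' : ((List.range (n + 1)).map fun t => φ (t + 1)) =
        φ 1 :: (List.range n).map (fun t => φ (t + 2)) := by
      rw [List.range_succ_eq_map]
      simp [Function.comp_def]
    rw [h, changes, ← h', ih, Finset.card_filter, Finset.card_filter, Finset.sum_range_succ',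
      add_comm]
    congr 1
    simp

end Words

/-! ### Counting in sets of words closed under duplication -/

theorem isUpperSet_of_increment {r : ℕ} {ℓ : Fin r → ℕ} {U : Set (∀ i, Fin (ℓ i) → ℕ)}
    (h : ∀ a ∈ U, ∀ i j, Function.update a i (Function.update (a i) j (a i j + 1)) ∈ U) :
    IsUpperSet U := by
  intro a a' haa' ha
  have hfin : (U ∩ Set.Iic a').Finite := (Set.finite_Iic a').inter_of_right _
  obtain ⟨b, hb⟩ := hfin.exists_maximal ⟨a, ha, haa'⟩
  by_cases hba : b = a'
  · exact hba ▸ hb.prop.1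
  exfalso
  have hlt : ∃ i j, b i j < a' i j := by
    by_contra hcon
    push Not at hcon
    exact hba (le_antisymm hb.prop.2 hcon)
  obtain ⟨i, j, hij⟩ := hlt
  set b' := Function.update b i (Function.update (b i) j (b i j + 1)) with hb'
  have h1 : b' i j = b i j + 1 := by simp [hb']
  have h2 : ∀ i' j', (i' ≠ i ∨ ∃ h : i' = i, h ▸ j' ≠ j) → b' i' j' = b i' j' := by
    rintro i' j' (hne | ⟨rfl, hne⟩)
    · simp [hb', Function.update_of_ne hne]
    · simp only [hb', Function.update_self]
      exact Function.update_of_ne hne _ _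
  have hle : ∀ i' j', b i' j' ≤ b' i' j' ∧ b' i' j' ≤ a' i' j' := by
    intro i' j'
    have hba' : b i' j' ≤ a' i' j' := hb.prop.2 i' j'
    by_cases hi : i' = i
    · subst hi
      by_cases hj : j' = j
      · subst hj; omega
      · rw [h2 i' j' (Or.inr ⟨rfl, hj⟩)]
        exact ⟨le_rfl, hba'⟩
    · rw [h2 i' j' (Or.inl hi)]
      exact ⟨le_rfl, hba'⟩
  have h3 := hb.le_of_ge ⟨h b hb.prop.1 i j, fun i' j' => (hle i' j').2⟩
    (fun i' j' => (hle i' j').1)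
  have h4 : b' i j ≤ b i j := h3 i j
  omega

/-- Tuples of words (with a decoration from the finite set `B`) in a set closed under
the duplication of letters, counted by lengths. Recording the lengths of the runs of equal letters
turns such a set into a finite union of upper sets of lattice points. -/
theorem eventuallyPolynomial_words {B W : Type} [Finite B] [Finite W] [DecidableEq W] {r : ℕ}
    (d : ℕ) (L : Set (B × (Fin r → List W))) (hne : ∀ z ∈ L, ∀ i, z.2 i ≠ [])
    (hch : ∀ z ∈ L, ∑ i, changes (z.2 i) ≤ d)
    (hdup : ∀ z ∈ L, ∀ i p, p < (z.2 i).length →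
      (z.1, Function.update z.2 i (dup p (z.2 i))) ∈ L) :
    EventuallyPolynomial d fun m =>
      ((L ∩ {z | ∀ i, (z.2 i).length = m i + 1}).ncard : ℚ) := by
  classical
  set Γ : Set (B × (Fin r → List W)) :=
    {γ | (∀ i, (γ.2 i).IsChain (· ≠ ·) ∧ γ.2 i ≠ []) ∧ ∑ i, ((γ.2 i).length - 1) ≤ d}
  have hΓfin : Γ.Finite := by
    refine ((Set.finite_univ (α := B)).prod
      (Set.Finite.pi' fun _ : Fin r => List.finite_length_le W (d + 1))).subset ?_
    rintro γ ⟨-, h2⟩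
    refine ⟨trivial, fun i => ?_⟩
    have h3 := (Finset.single_le_sum (f := fun i => (γ.2 i).length - 1)
      (fun _ _ => Nat.zero_le _) (Finset.mem_univ i)).trans h2
    change (γ.2 i).length ≤ d + 1
    omega
  have : Fintype Γ := hΓfin.fintype
  set U : ∀ γ : B × (Fin r → List W), Set (∀ i, Fin (γ.2 i).length → ℕ) :=
    fun γ => {a | (γ.1, fun i => expand (γ.2 i) (a i)) ∈ L}
  have hUpper : ∀ γ, IsUpperSet (U γ) := by
    refine fun γ => isUpperSet_of_increment fun a ha i j => ?_
    obtain ⟨p, hp, h⟩ := exists_dup_expand (γ.2 i) (a i) j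
    have := hdup _ ha i p hp
    simp only [← h] at this
    change (γ.1, _) ∈ L
    convert this using 2
    funext i'
    by_cases hi : i' = i
    · subst hi; simp
    · simp [Function.update_of_ne hi]
  have hlen : ∀ γ ∈ Γ, ∀ i, (γ.2 i).length = ((γ.2 i).length - 1) + 1 := fun γ hγ i =>
    (Nat.succ_pred_eq_of_pos (List.length_pos_iff.2 (hγ.1 i).2)).symm
  have hcount : ∀ m : Fin r → ℕ, (L ∩ {z | ∀ i, (z.2 i).length = m i + 1}).ncard =
      ∑ γ : Γ, (U γ.1 ∩ slice (fun i => (γ.1.2 i).length - 1) m).ncard := by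
    intro m
    have hf : ∀ γ : Γ, Finite ↥(U γ.1 ∩ slice (fun i => (γ.1.2 i).length - 1) m) := fun γ =>
      ((slice_finite _ m).inter_of_right _).to_subtype
    have hE : ∀ (γ : Γ) (a : ∀ i, Fin (γ.1.2 i).length → ℕ),
        a ∈ slice (fun i => (γ.1.2 i).length - 1) m ↔
          ∀ i, (expand (γ.1.2 i) (a i)).length = m i + 1 := by
      intro γ a
      refine forall_congr' fun i => ?_
      have := hlen γ.1 γ.2 i
      rw [length_expand]
      change (γ.1.2 i).length - 1 + ∑ j, a i j = m i ↔ _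
      omega
    let E : (Σ γ : Γ, ↥(U γ.1 ∩ slice (fun i => (γ.1.2 i).length - 1) m)) →
        ↥(L ∩ {z | ∀ i, (z.2 i).length = m i + 1}) := fun x =>
      ⟨(x.1.1.1, fun i => expand (x.1.1.2 i) (x.2.1 i)), x.2.2.1, (hE _ _).1 x.2.2.2⟩
    have hEbij : Function.Bijective E := by
      constructor
      · rintro ⟨⟨⟨b, c⟩, hγ⟩, a, ha⟩ ⟨⟨⟨b', c'⟩, hγ'⟩, a', ha'⟩ h
        have h0 : (b, fun i => expand (c i) (a i)) = (b', fun i => expand (c' i) (a' i)) :=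
          congrArg Subtype.val h
        rw [Prod.mk.injEq] at h0
        obtain ⟨rfl, h1⟩ := h0
        have h2 := fun i => expand_injective (hγ.1 i).1 (hγ'.1 i).1 (congrFun h1 i)
        obtain rfl : c = c' := funext fun i => congrArg Sigma.fst (h2 i)
        obtain rfl : a = a' := funext fun i => eq_of_heq (Sigma.mk.inj (h2 i)).2
        rfl
      · rintro ⟨⟨b, w⟩, hz, hm⟩
        choose c a hc hw using fun i => exists_expand_eq (w i)
        have hc0 : ∀ i, c i ≠ [] := by
          intro i hi
          apply hne _ hz i
          have h1 := head?_expand (c i) (a i)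
          rw [hw i, hi] at h1
          simpa using h1
        have hγ : (b, c) ∈ Γ := by
          refine ⟨fun i => ⟨hc i, hc0 i⟩, le_trans (Finset.sum_le_sum fun i _ => ?_) (hch _ hz)⟩
          change _ ≤ changes (w i)
          rw [← hw i, changes_expand _ _ (hc i)]
        have hw' : (fun i => expand (c i) (a i)) = w := funext hw
        refine ⟨⟨⟨(b, c), hγ⟩, a, ?_, (hE ⟨(b, c), hγ⟩ a).2 ?_⟩, ?_⟩
        · change (b, fun i => expand (c i) (a i)) ∈ L
          rw [hw']; exact hz
        · intro i
          change (expand (c i) (a i)).length = _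
          rw [hw]; exact hm i
        · apply Subtype.ext
          change (b, fun i => expand (c i) (a i)) = _
          rw [hw']
    rw [← Nat.card_coe_set_eq, ← Nat.card_congr (Equiv.ofBijective E hEbij), Nat.card_sigma]
    exact Finset.sum_congr rfl fun γ _ => Nat.card_coe_set_eq _
  refine (EventuallyPolynomial.sum Finset.univ fun (γ : Γ) _ =>
    ((IsUpperSet.eventuallyPolynomial_slice (hUpper γ.1) (fun i => (γ.1.2 i).length - 1)
      (hlen γ.1 γ.2) fun i => (γ.1.2 i).length - 1).mono γ.2.2)).congr 0 fun m _ => ?_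
  rw [hcount, Nat.cast_sum]

/-! ### Leading terms -/

section Leading

variable {k : Type*} [Field k] {X Λ : Type*} [LinearOrder Λ]

/-- `x` is the leading basis element of the vector `s`, for the order on the basis `X` pulled back
along `code`. -/
def IsLeading (code : X → Λ) (s : X → k) (x : X) : Prop :=
  s x ≠ 0 ∧ ∀ y, s y ≠ 0 → code y ≤ code x

theorem exists_isLeading [Finite X] (code : X → Λ) {s : X → k} (hs : s ≠ 0) :
    ∃ x, IsLeading code s x := by
  obtain ⟨x, hx, hmax⟩ := (Set.toFinite {x | s x ≠ 0}).exists_maximalFor code _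
    (Function.ne_iff.1 hs)
  exact ⟨x, hx, fun y hy => le_of_not_gt fun h => h.not_ge (hmax hy h.le)⟩

/-- The dimension of a space of vectors, embedded in a coordinate space by `φ`, is the number of
its leading basis elements. -/
theorem finrank_eq_ncard_isLeading [Finite X] {code : X → Λ} (hcode : Function.Injective code)
    {V : Type*} [AddCommGroup V] [Module k V] (φ : V →ₗ[k] X → k) (hφ : Function.Injective φ)
    (S : Submodule k V) :
    Module.finrank k S = {x | ∃ s ∈ S, IsLeading code (φ s) x}.ncard := by
  classical
  set A : Set X := {x | ∃ s ∈ S, IsLeading code (φ s) x}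
  have : Fintype A := Fintype.ofFinite A
  have : FiniteDimensional k V := FiniteDimensional.of_injective φ hφ
  rw [← Nat.card_coe_set_eq, Nat.card_eq_fintype_card]
  apply le_antisymm
  · let ρ : S →ₗ[k] (A → k) := (LinearMap.funLeft k k Subtype.val) ∘ₗ φ ∘ₗ S.subtype
    have hρ : Function.Injective ρ := by
      refine (injective_iff_map_eq_zero ρ).2 fun s hs => ?_
      by_contra hne
      have hne' : φ s.1 ≠ 0 := fun h => hne (Subtype.ext (hφ (h.trans (map_zero φ).symm)))
      obtain ⟨x, hx⟩ := exists_isLeading code hne'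
      exact hx.1 (congrFun hs ⟨x, s.1, s.2, hx⟩)
    have := LinearMap.finrank_le_finrank_of_injective hρ
    rwa [Module.finrank_fintype_fun_eq_card] at this
  · choose σ hσS hσ using fun x : A => x.2
    have hli : LinearIndependent k fun x : A => (⟨σ x, hσS x⟩ : S) := by
      refine Fintype.linearIndependent_iff.2 fun g hg => ?_
      by_contra! hne
      -- the largest leading element that occurs cannot cancel
      obtain ⟨x, hx, hmax⟩ := (Finset.univ.filter fun x => g x ≠ 0).exists_max_image
        (fun x : A => code x.1) ⟨hne.choose, by simpa using hne.choose_spec⟩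
      have h1 : ∑ y, g y * φ (σ y) x.1 = 0 := by
        have := congrArg (fun s : S => φ s.1 x.1) hg
        simpa [Finset.sum_apply] using this
      rw [Finset.sum_eq_single x] at h1
      · rcases mul_eq_zero.1 h1 with h | h
        · exact (Finset.mem_filter.1 hx).2 h
        · exact (hσ x).1 h
      · intro y _ hyx
        by_cases hy : g y = 0
        · rw [hy, zero_mul]
        · by_cases h2 : φ (σ y) x.1 = 0
          · rw [h2, mul_zero]
          · have h3 := hmax y (by simpa using hy)
            have h4 := (hσ y).2 _ h2
            exact absurd (Subtype.ext (hcode (le_antisymm h3 h4))) hyx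
      · simp
    exact hli.fintype_card_le_finrank

theorem IsLeading.mapDomain {X' Λ' : Type*} [LinearOrder Λ'] {code : X → Λ} {code' : X' → Λ'}
    (hcode : Function.Injective code) {D : X → X'}
    (hD : ∀ x y, code x < code y → code' (D x) < code' (D y)) {s : X →₀ k} {x : X}
    (hx : IsLeading code s x) : IsLeading code' (Finsupp.mapDomain D s) (D x) := by
  have hle : ∀ x y, code x ≤ code y → code' (D x) ≤ code' (D y) := fun x y h => by
    rcases h.lt_or_eq with h | h
    · exact (hD x y h).le
    · rw [hcode h]
  have hinj : Function.Injective D := by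
    intro x y hxy
    by_contra hne
    rcases lt_or_gt_of_ne fun h => hne (hcode h) with h | h
    · exact (hD _ _ h).ne (by rw [hxy])
    · exact (hD _ _ h).ne (by rw [hxy])
  refine ⟨by rw [Finsupp.mapDomain_apply hinj]; exact hx.1, fun z hz => ?_⟩
  classical
  have hz' := Finsupp.mapDomain_support (Finsupp.mem_support_iff.2 hz)
  obtain ⟨y, hy, rfl⟩ := Finset.mem_image.1 hz'
  exact hle _ _ (hx.2 y (Finsupp.mem_support_iff.1 hy))

end Leading

section Lex

variable {W : Type*} [LinearOrder W]

theorem dup_lt_dup : ∀ {u v : List W} (p : ℕ), u.length = v.length → u < v → dup p u < dup p v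
  | [], [], _, _, h => absurd h (lt_irrefl _)
  | [], _ :: _, _, hl, _ => by simp at hl
  | _ :: _, [], _, hl, _ => by simp at hl
  | x :: u, y :: v, p, hl, h => by
    rw [List.cons_lt_cons_iff] at h
    cases p with
    | zero =>
      change x :: x :: u < y :: y :: v
      rw [List.cons_lt_cons_iff, List.cons_lt_cons_iff]
      rcases h with h | ⟨h1, h2⟩
      · exact Or.inl h
      · exact Or.inr ⟨h1, Or.inr ⟨h1, h2⟩⟩
    | succ p =>
      change x :: dup p u < y :: dup p v
      rw [List.cons_lt_cons_iff]
      rcases h with h | ⟨h1, h2⟩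
      · exact Or.inl h
      · exact Or.inr ⟨h1, dup_lt_dup p (by simpa using hl) h2⟩

theorem update_dup_lt_update_dup {r : ℕ} {w w' : Fin r → List W}
    (hl : ∀ i, (w i).length = (w' i).length) (h : toLex w < toLex w') (i : Fin r) (p : ℕ) :
    toLex (Function.update w i (dup p (w i))) < toLex (Function.update w' i (dup p (w' i))) := by
  obtain ⟨j, h1, h2⟩ := h
  have h1' : ∀ j' < j, w j' = w' j' := h1
  have h2' : w j < w' j := h2
  refine ⟨j, fun j' hj' => ?_, ?_⟩
  · change Function.update w i _ j' = Function.update w' i _ j'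
    by_cases hi : j' = i
    · subst hi; simp [h1' j' hj']
    · simp [Function.update_of_ne hi, h1' j' hj']
  · change Function.update w i _ j < Function.update w' i _ j
    by_cases hi : j = i
    · subst hi; simpa using dup_lt_dup p (hl j) h2'
    · simpa [Function.update_of_ne hi] using h2'

/-- Let `X m` be finite sets of tuples of words of lengths `m i + 1`, on which the duplication of
letters acts, and let `S m` be subspaces of the free vector spaces on `X m` that are stable under
this action. Then `dim (S m)` is eventually polynomial: the leading elements of the `S m`, for the
lexicographic order, form a set closed under duplication. -/
theorem eventuallyPolynomial_finrank {k : Type*} [Field k] {r : ℕ} (N₀ d : ℕ)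
    {X : ∀ m : Fin r → ℕ, (∀ i, N₀ ≤ m i) → Type*} [∀ m h, Finite (X m h)]
    {B W : Type} [Finite B] [Finite W] [LinearOrder B] [LinearOrder W]
    (code : ∀ {m h}, X m h → B × (Fin r → List W))
    (hinj : ∀ m h, Function.Injective (code (m := m) (h := h)))
    (hlen : ∀ m h (x : X m h) i, ((code x).2 i).length = m i + 1)
    (hch : ∀ m h (x : X m h), ∑ i, changes ((code x).2 i) ≤ d)
    (S : ∀ m h, Submodule k (X m h →₀ k))
    (hD : ∀ m h i p h', p ≤ m i → ∃ D : X m h → X (m + Pi.single i 1) h',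
      (∀ x, code (D x) = ((code x).1, Function.update (code x).2 i (dup p ((code x).2 i)))) ∧
      ∀ s ∈ S m h, Finsupp.mapDomain D s ∈ S _ h') :
    EventuallyPolynomial d fun m =>
      if h : ∀ i, N₀ ≤ m i then (Module.finrank k (S m h) : ℚ) else 0 := by
  let code' : ∀ {m h}, X m h → B ×ₗ Lex (Fin r → List W) := fun x =>
    toLex ((code x).1, toLex (code x).2)
  have hinj' : ∀ m h, Function.Injective (code' (m := m) (h := h)) := fun m h x y hxy =>
    hinj m h hxy
  let L : Set (B × (Fin r → List W)) :=
    {z | ∃ m h, ∃ x : X m h, code x = z ∧ ∃ s ∈ S m h, IsLeading code' s x}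
  have hcount : ∀ m (h : ∀ i, N₀ ≤ m i), Module.finrank k (S m h) =
      (L ∩ {z | ∀ i, (z.2 i).length = m i + 1}).ncard := by
    intro m h
    rw [finrank_eq_ncard_isLeading (hinj' m h) Finsupp.lcoeFun DFunLike.coe_injective,
      ← Set.ncard_image_of_injective _ (hinj m h)]
    congr 1
    ext z
    constructor
    · rintro ⟨x, hx, rfl⟩
      exact ⟨⟨m, h, x, rfl, hx⟩, hlen m h x⟩
    · rintro ⟨⟨m', h', x, rfl, hx⟩, hz⟩
      obtain rfl : m' = m := by
        funext i
        have h1 := hlen m' h' x i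
        have h2 := hz i
        omega
      exact ⟨x, hx, rfl⟩
  refine (eventuallyPolynomial_words d L ?_ ?_ ?_).congr N₀ fun m hm => ?_
  · rintro _ ⟨m, h, x, rfl, -⟩ i hi
    have := hlen m h x i
    simp [hi] at this
  · rintro _ ⟨m, h, x, rfl, -⟩
    exact hch m h x
  · rintro _ ⟨m, h, x, rfl, s, hs, hx⟩ i p hp
    rw [hlen] at hp
    have h' : ∀ j, N₀ ≤ (m + Pi.single i 1 : Fin r → ℕ) j := fun j =>
      (h j).trans (Nat.le_add_right _ _)
    obtain ⟨D, hD1, hD2⟩ := hD m h i p h' (Nat.lt_succ_iff.1 hp)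
    refine ⟨_, h', D x, hD1 x, _, hD2 s hs, hx.mapDomain (hinj' m h) fun y z hyz => ?_⟩
    change toLex ((code (D y)).1, toLex (code (D y)).2) <
      toLex ((code (D z)).1, toLex (code (D z)).2)
    rw [hD1, hD1, Prod.Lex.toLex_lt_toLex]
    rcases Prod.Lex.toLex_lt_toLex.1 hyz with h1 | ⟨h1, h2⟩
    · exact Or.inl h1
    · exact Or.inr ⟨h1, update_dup_lt_update_dup (fun j => by rw [hlen, hlen]) h2 i p⟩
  · rw [dif_pos hm, hcount]

end Lex

/-! ### Dimensions of filtered vector spaces and of subquotients -/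

section Filtered

variable {k : Type*} [Field k] {V : Type*} [AddCommGroup V] [Module k V]

theorem finite_and_finrank_succ {P Q : Submodule k V} (h : P ≤ Q) [Module.Finite k P]
    [Module.Finite k (Q ⧸ P.submoduleOf Q)] :
    Module.Finite k Q ∧
      Module.finrank k Q = Module.finrank k P + Module.finrank k (Q ⧸ P.submoduleOf Q) := by
  have e := Submodule.submoduleOfEquivOfLe h
  have : Module.Finite k (P.submoduleOf Q) := Module.Finite.equiv e.symm
  have hQ : Module.Finite k Q := Module.Finite.of_submodule_quotient (P.submoduleOf Q)
  refine ⟨hQ, ?_⟩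
  rw [← (P.submoduleOf Q).finrank_quotient_add_finrank, e.finrank_eq, add_comm]

/-- A vector space with an exhaustive and separated `ℤ`-indexed filtration has the dimension of the
associated graded space when the latter is finite dimensional: such a filtration is finite. -/
theorem finite_and_finrank_of_filtration (p : ℤ → Submodule k V) (hp : Monotone p)
    (htop : ⨆ i, p i = ⊤) (hbot : ⨅ i, p i = ⊥)
    [hfin : Module.Finite k (DirectSum ℤ fun i => p i ⧸ (p (i - 1)).submoduleOf (p i))] :
    Module.Finite k V ∧ Module.finrank k V =
      Module.finrank k (DirectSum ℤ fun i => p i ⧸ (p (i - 1)).submoduleOf (p i)) := by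
  classical
  set G : ℤ → Type _ := fun i => p i ⧸ (p (i - 1)).submoduleOf (p i)
  have hGfin : ∀ i, Module.Finite k (G i) := fun i =>
    FiniteDimensional.of_injective (V₂ := DirectSum ℤ fun i => p i ⧸ (p (i - 1)).submoduleOf (p i))
      (DirectSum.lof k ℤ G i) (DirectSum.of_injective i)
  set n : ℤ → ℕ := fun i => Module.finrank k (G i)
  let b : Module.Basis (Σ i, Fin (n i)) k (DirectSum ℤ G) :=
    DFinsupp.basis fun i => Module.finBasis k (G i)
  have hfinite : Finite (Σ i, Fin (n i)) := Module.Finite.finite_basis b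
  have hsupp : {i | n i ≠ 0}.Finite := by
    refine (Set.finite_range (Sigma.fst : (Σ i, Fin (n i)) → ℤ)).subset fun i hi => ?_
    exact ⟨⟨i, ⟨0, Nat.pos_of_ne_zero hi⟩⟩, rfl⟩
  have hstep : ∀ i, n i = 0 → p i = p (i - 1) := by
    intro i hi
    refine le_antisymm ?_ (hp (by omega))
    have h1 : Subsingleton (G i) := Module.finrank_zero_iff.1 hi
    have h2 := Submodule.Quotient.subsingleton_iff.1 h1
    intro x hx
    have h3 : (⟨x, hx⟩ : p i) ∈ (p (i - 1)).submoduleOf (p i) := h2 ▸ Submodule.mem_top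
    exact h3
  obtain ⟨a, ha⟩ := hsupp.bddBelow
  obtain ⟨c, hc⟩ := hsupp.bddAbove
  have hlow : ∀ i, i < a → n i = 0 := fun i hi => by
    by_contra h
    exact absurd (ha h) (by omega)
  have hhigh : ∀ i, c < i → n i = 0 := fun i hi => by
    by_contra h
    exact absurd (hc h) (by omega)
  have hbot' : p (a - 1) = ⊥ := by
    rw [← hbot]
    refine le_antisymm (le_iInf fun i => ?_) (iInf_le _ _)
    rcases le_total (a - 1) i with h | h
    · exact hp h
    · refine Int.leInductionDown (motive := fun i _ => p (a - 1) ≤ p i) le_rfl ?_ i h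
      intro j hj ih
      rwa [← hstep j (hlow j (by omega))]
  set N : ℕ := (c - a + 1).toNat with hN
  have htop' : p (a - 1 + N) = ⊤ := by
    rw [← htop]
    refine le_antisymm (le_iSup _ _) (iSup_le fun i => ?_)
    rcases le_total i (a - 1 + N) with h | h
    · exact hp h
    · refine Int.leInduction (motive := fun i _ => p i ≤ p (a - 1 + N)) le_rfl ?_ i h
      intro j hj ih
      rw [hstep (j + 1) (hhigh _ (by omega))]
      simpa using ih
  have hdim : ∀ t : ℕ, Module.Finite k (p (a - 1 + t)) ∧
      Module.finrank k (p (a - 1 + t)) = ∑ j : Fin t, n (a + j) := by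
    intro t
    induction t with
    | zero =>
      have h0 : p (a - 1 + (0 : ℕ)) = ⊥ := by simpa using hbot'
      rw [h0]
      exact ⟨inferInstance, by simp⟩
    | succ t ih =>
      have h0 : a - 1 + (t + 1 : ℕ) = a + t := by push_cast; ring
      have h1 : a - 1 + (t : ℤ) = a + t - 1 := by ring
      rw [h0, Fin.sum_univ_castSucc]
      rw [h1] at ih
      have := ih.1
      have : Module.Finite k (p (a + t) ⧸ (p (a + t - 1)).submoduleOf (p (a + t))) :=
        hGfin (a + t)
      obtain ⟨h2, h3⟩ := finite_and_finrank_succ (hp (show a + t - 1 ≤ a + (t : ℤ) by omega))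
      refine ⟨h2, ?_⟩
      rw [h3, ih.2]
      rfl
  obtain ⟨h1, h2⟩ := hdim N
  rw [htop'] at h1 h2
  have hV : Module.Finite k V := Module.Finite.equiv Submodule.topEquiv
  refine ⟨hV, ?_⟩
  rw [finrank_top] at h2
  rw [h2, Module.finrank_eq_nat_card_basis b]
  let E : (Σ j : Fin N, Fin (n (a + j))) → Σ i, Fin (n i) := fun x => ⟨a + x.1, x.2⟩
  have hE : Function.Bijective E := by
    constructor
    · rintro ⟨j, t⟩ ⟨j', t'⟩ h
      obtain ⟨h3, h4⟩ := Sigma.mk.inj h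
      obtain rfl : j = j' := Fin.ext (by simpa using h3)
      obtain rfl : t = t' := eq_of_heq h4
      rfl
    · rintro ⟨i, t⟩
      have h3 : n i ≠ 0 := fun h => by
        have := t.2
        omega
      have h4 : a ≤ i := ha h3
      have h5 : i ≤ c := hc h3
      obtain ⟨j, rfl⟩ : ∃ j : ℕ, i = a + j := ⟨(i - a).toNat, by omega⟩
      exact ⟨⟨⟨j, by omega⟩, t⟩, rfl⟩
  rw [← Nat.card_congr (Equiv.ofBijective E hE), Nat.card_sigma]
  simp

theorem finrank_comap_of_surjective {V' : Type*} [AddCommGroup V'] [Module k V']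
    [Module.Finite k V] (q : V →ₗ[k] V') (hq : Function.Surjective q) (P : Submodule k V') :
    Module.finrank k (P.comap q) = Module.finrank k P + Module.finrank k (LinearMap.ker q) := by
  have hle : LinearMap.ker q ≤ P.comap q := fun x hx => by
    rw [Submodule.mem_comap, LinearMap.mem_ker.1 hx]
    exact P.zero_mem
  have e := (Submodule.submoduleOfEquivOfLe hle).finrank_eq
  let ρ : P.comap q →ₗ[k] P := q.restrict fun _ hx => hx
  have hρ : Function.Surjective ρ := by
    rintro ⟨y, hy⟩
    obtain ⟨x, rfl⟩ := hq y
    exact ⟨⟨x, hy⟩, rfl⟩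
  have hker : LinearMap.ker ρ = (LinearMap.ker q).submoduleOf (P.comap q) := by
    ext x
    rw [LinearMap.mem_ker, Submodule.submoduleOf, Submodule.mem_comap, LinearMap.mem_ker,
      ← Subtype.coe_inj]
    rfl
  have h := ρ.finrank_range_add_finrank_ker
  rw [LinearMap.range_eq_top.2 hρ, finrank_top, hker, e] at h
  exact h.symm

end Filtered

section SmallModules

variable {k : Type u} [Field k] {C : Type v} [Category.{0} C]

/-- The linear map from the free vector space on the morphisms from the `x j` to `y` that is given
by elements `ν j` of the `N (x j)`; its image is the value at `y` of the submodule generated by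
the `ν j`. -/
noncomputable def generatorMap {ι : Type} {x : ι → C} (N : C ⥤ ModuleCat.{u} k)
    (ν : ∀ j, N.obj (x j)) (y : C) : ((Σ j, (x j ⟶ y)) →₀ k) →ₗ[k] N.obj y :=
  Finsupp.linearCombination k fun z => (N.map z.2).hom (ν z.1)

theorem generatorMap_mapDomain {ι : Type} {x : ι → C} (N : C ⥤ ModuleCat.{u} k)
    (ν : ∀ j, N.obj (x j)) {y y' : C} (D : y ⟶ y') (s : (Σ j, (x j ⟶ y)) →₀ k) :
    generatorMap N ν y' (Finsupp.mapDomain (fun z => ⟨z.1, z.2 ≫ D⟩) s) =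
      (N.map D).hom (generatorMap N ν y s) := by
  rw [generatorMap, Finsupp.linearCombination_mapDomain, generatorMap,
    Finsupp.apply_linearCombination]
  congr 2
  funext z
  simp

/-- The element of `N x` that corresponds to a map `P_x ⟶ N` by the Yoneda lemma. -/
noncomputable def yonedaElement {x : C} {N : C ⥤ ModuleCat.{u} k}
    (φ : principalProjective k x ⟶ N) : N.obj x :=
  (show ((x ⟶ x) →₀ k) →ₗ[k] N.obj x from (φ.app x).hom) (Finsupp.single (𝟙 x) 1)

theorem principalProjective_app_hom {x : C} {N : C ⥤ ModuleCat.{u} k}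
    (φ : principalProjective k x ⟶ N) (y : C) :
    (show ((x ⟶ y) →₀ k) →ₗ[k] N.obj y from (φ.app y).hom) =
      Finsupp.linearCombination k fun g => (N.map g).hom (yonedaElement φ) := by
  refine Finsupp.lhom_ext' fun g => LinearMap.ext_ring ?_
  have h := congrArg (fun t => t.hom (Finsupp.single (𝟙 x) 1)) (φ.naturality g)
  change (φ.app y).hom (Finsupp.mapDomain (fun g' => g' ≫ g) (Finsupp.single (𝟙 x) 1)) =
    (N.map g).hom (yonedaElement φ) at h
  rw [Finsupp.mapDomain_single, Category.id_comp] at h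
  rw [LinearMap.comp_apply, LinearMap.comp_apply, Finsupp.lsingle_apply,
    Finsupp.linearCombination_single, one_smul, ← h]
  rfl

theorem exists_generatorMap_surjective {deg : C → ℕ} {d : ℕ} {N : C ⥤ ModuleCat.{u} k}
    (h : GeneratedInDegreeLE deg d N) :
    ∃ (n : ℕ) (x : Fin n → C) (ν : ∀ j, N.obj (x j)), (∀ j, deg (x j) ≤ d) ∧
      ∀ y, Function.Surjective (generatorMap N ν y) := by
  obtain ⟨n, x, hx, p, hp⟩ := h
  let P : Fin n → (C ⥤ ModuleCat.{u} k) := fun j => principalProjective k (x j)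
  have : HasFiniteBiproducts (C ⥤ ModuleCat.{u} k) := HasFiniteBiproducts.of_hasFiniteCoproducts
  let p' : (⨁ P) ⟶ N := (biproduct.isoCoproduct P).hom ≫ p
  have hp' : Epi p' := inferInstance
  refine ⟨n, x, fun j => yonedaElement (biproduct.ι P j ≫ p'), hx, fun y => ?_⟩
  rw [← LinearMap.range_eq_top, eq_top_iff]
  intro b _
  have hepi : Epi (p'.app y) := inferInstance
  obtain ⟨z, rfl⟩ := (ModuleCat.epi_iff_surjective _).1 hepi b
  have hz : p' = ∑ j, biproduct.π P j ≫ biproduct.ι P j ≫ p' := by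
    conv_lhs => rw [← Category.id_comp p', ← biproduct.total, Preadditive.sum_comp]
    simp
  have hz' : (p'.app y).hom z =
      ∑ j, ((biproduct.ι P j ≫ p').app y).hom (((biproduct.π P j).app y).hom z) := by
    have h1 := congrArg (fun t : (⨁ P) ⟶ N => (t.app y).hom z) hz
    refine h1.trans ?_
    simp [NatTrans.app_sum, ModuleCat.hom_sum, LinearMap.sum_apply]
  change (p'.app y).hom z ∈ _
  rw [hz']
  refine Submodule.sum_mem _ fun j _ => ?_
  let w : (x j ⟶ y) →₀ k := ((biproduct.π P j).app y).hom z
  refine ⟨Finsupp.mapDomain (Sigma.mk j) w, ?_⟩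
  rw [generatorMap, Finsupp.linearCombination_mapDomain]
  exact (LinearMap.congr_fun (principalProjective_app_hom (biproduct.ι P j ≫ p') y) w).symm

/-- The values of a small module are quotients `S y ⧸ K y` of subspaces, stable under the action of
all morphisms, of the free vector spaces on the morphisms from finitely many objects of bounded
degree. -/
theorem IsSmall.exists_subquotient {deg : C → ℕ} {d : ℕ} {M : C ⥤ ModuleCat.{u} k}
    (h : IsSmall deg d M) :
    ∃ (n : ℕ) (x : Fin n → C) (S K : ∀ y, Submodule k ((Σ j, (x j ⟶ y)) →₀ k)),
      (∀ j, deg (x j) ≤ d) ∧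
      (∀ {y y' : C} (D : y ⟶ y'), ∀ s ∈ S y,
        Finsupp.mapDomain (fun z : Σ j, (x j ⟶ y) => (⟨z.1, z.2 ≫ D⟩ : Σ j, (x j ⟶ y'))) s ∈ S y') ∧
      (∀ {y y' : C} (D : y ⟶ y'), ∀ s ∈ K y,
        Finsupp.mapDomain (fun z : Σ j, (x j ⟶ y) => (⟨z.1, z.2 ≫ D⟩ : Σ j, (x j ⟶ y'))) s ∈ K y') ∧
      ∀ y, Finite (Σ j, (x j ⟶ y)) → Module.Finite k (M.obj y) ∧
        Module.finrank k (M.obj y) + Module.finrank k (K y) = Module.finrank k (S y) := by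
  obtain ⟨N, hN, S, i, p, hi, hp⟩ := h
  obtain ⟨n, x, ν, hx, hν⟩ := exists_generatorMap_surjective hN
  refine ⟨n, x, fun y => (LinearMap.range (i.app y).hom).comap (generatorMap N ν y),
    fun y => ((LinearMap.ker (p.app y).hom).map (i.app y).hom).comap (generatorMap N ν y),
    hx, ?_, ?_, ?_⟩
  · rintro y y' D s ⟨a, ha⟩
    rw [Submodule.mem_comap, generatorMap_mapDomain, ← ha]
    exact ⟨(S.map D).hom a, congrArg (fun t => t.hom a) (i.naturality D)⟩
  · rintro y y' D s ⟨a, ha, ha'⟩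
    rw [Submodule.mem_comap, generatorMap_mapDomain, ← ha']
    refine ⟨(S.map D).hom a, ?_, congrArg (fun t => t.hom a) (i.naturality D)⟩
    have h1 := congrArg (fun t => t.hom a) (p.naturality D)
    simp only [ModuleCat.hom_comp, LinearMap.comp_apply] at h1
    change (p.app y').hom ((S.map D).hom a) = 0
    rw [h1, LinearMap.mem_ker.1 ha, map_zero]
  · intro y hy
    have hNfin : Module.Finite k (N.obj y) := Module.Finite.of_surjective _ (hν y)
    have hiy : Function.Injective (i.app y).hom :=
      (ModuleCat.mono_iff_injective _).1 (inferInstance : Mono (i.app y))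
    have hpy : Function.Surjective (p.app y).hom :=
      (ModuleCat.epi_iff_surjective _).1 (inferInstance : Epi (p.app y))
    have hSfin : Module.Finite k (S.obj y) := Module.Finite.of_injective _ hiy
    refine ⟨Module.Finite.of_surjective _ hpy, ?_⟩
    rw [finrank_comap_of_surjective _ (hν y), finrank_comap_of_surjective _ (hν y),
      LinearMap.finrank_range_of_inj hiy,
      ← (Submodule.equivMapOfInjective _ hiy (LinearMap.ker (p.app y).hom)).finrank_eq,
      ← (p.app y).hom.finrank_range_add_finrank_ker, LinearMap.range_eq_top.2 hpy, finrank_top,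
      add_assoc]

end SmallModules

/-! ### Dimension growth along a family of objects described by words -/

/-- A family of objects `obj m` of `C`, for `m : Fin r → ℕ` with all `m i ≥ N₀`, such that a
morphism `x ⟶ obj m` is determined by a tuple of words over the finite alphabet `V x`: a base word
indexed by `B`, and for each `i` a word `path i` of length `m i + 1` with letters numbered
`0, …, m i` (letters beyond the last one repeat it). These words change their letter at most
`deg x` times in total, and duplicating a letter of the `i`-th word is composition with a morphism
`obj m ⟶ obj (m + Pi.single i 1)`. -/
structure WordModel {C : Type v} [Category.{0} C] (deg : C → ℕ) (r N₀ : ℕ) where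
  obj : ∀ m : Fin r → ℕ, (∀ i, N₀ ≤ m i) → C
  B : Type
  [finiteB : Finite B]
  [nonemptyB : Nonempty B]
  V : C → Type
  [finiteV : ∀ x, Finite (V x)]
  base : ∀ {x m h}, (x ⟶ obj m h) → B → V x
  path : ∀ {x m h}, (x ⟶ obj m h) → Fin r → ℕ → V x
  ext : ∀ {x m h} (f g : x ⟶ obj m h), base f = base g →
    (∀ i t, t ≤ m i → path f i t = path g i t) → f = g
  card_changes_le : ∀ {x m h} (f : x ⟶ obj m h) [DecidableEq (V x)],
    ∑ i, ((Finset.range (m i)).filter fun t => path f i t ≠ path f i (t + 1)).card ≤ deg x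
  exists_dup : ∀ m h i p h', p ≤ m i → ∃ D : obj m h ⟶ obj (m + Pi.single i 1) h',
    ∀ x (f : x ⟶ obj m h), base (f ≫ D) = base f ∧
      ∀ i' t, path (f ≫ D) i' t = path f i' (if i' = i ∧ p < t then t - 1 else t)

attribute [instance] WordModel.finiteB WordModel.nonemptyB WordModel.finiteV

theorem dup_map_range {W : Type*} (φ : ℕ → W) {n p : ℕ} (hp : p ≤ n) :
    dup p ((List.range (n + 1)).map φ) =
      (List.range (n + 1 + 1)).map fun t => φ (if p < t then t - 1 else t) := by
  refine List.ext_getElem ?_ fun t h1 h2 => ?_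
  · simp [dup]
    omega
  · simp only [dup, List.getElem_append, List.getElem_take, List.getElem_drop, List.getElem_map,
      List.getElem_range, List.length_take, List.length_map, List.length_range]
    split_ifs <;> first | rfl | (congr 1; omega)

namespace WordModel

variable {C : Type v} [Category.{0} C] {deg : C → ℕ} {r N₀ : ℕ} (Y : WordModel deg r N₀)

theorem finite_hom {n : ℕ} (x : Fin n → C) (m h) : Finite (Σ j, (x j ⟶ Y.obj m h)) := by
  have : ∀ j, Finite (x j ⟶ Y.obj m h) := fun j =>
    Finite.of_injective (β := (Y.B → Y.V (x j)) × (∀ i, Fin (m i + 1) → Y.V (x j)))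
      (fun f => (Y.base f, fun i t => Y.path f i t)) fun f g hfg => by
        obtain ⟨h1, h2⟩ := Prod.mk.inj hfg
        refine Y.ext f g h1 fun i t ht => ?_
        exact congrFun (congrFun h2 i) ⟨t, Nat.lt_succ_of_le ht⟩
  infer_instance

theorem eventuallyPolynomial_finrank_stable {k : Type*} [Field k] {d n : ℕ} (x : Fin n → C)
    (hx : ∀ j, deg (x j) ≤ d) (S : ∀ y, Submodule k ((Σ j, (x j ⟶ y)) →₀ k))
    (hS : ∀ {y y' : C} (D : y ⟶ y'), ∀ s ∈ S y,
      Finsupp.mapDomain (fun z : Σ j, (x j ⟶ y) => (⟨z.1, z.2 ≫ D⟩ : Σ j, (x j ⟶ y'))) s ∈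
        S y') :
    EventuallyPolynomial d fun m =>
      if h : ∀ i, N₀ ≤ m i then (Module.finrank k (S (Y.obj m h)) : ℚ) else 0 := by
  classical
  -- the alphabet consists of the letters of all the `x j`, so a word determines `j`
  let W : Type := Σ j, Y.V (x j)
  let e := Finite.equivFin W
  let e' := Finite.equivFin (Y.B → W)
  have := fun m h => Y.finite_hom x m h
  let code : ∀ {m h}, (Σ j, (x j ⟶ Y.obj m h)) →
      Fin (Nat.card (Y.B → W)) × (Fin r → List (Fin (Nat.card W))) := fun {m h} z =>
    (e' fun b => ⟨z.1, Y.base z.2 b⟩,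
      fun i => (List.range (m i + 1)).map fun t => e ⟨z.1, Y.path z.2 i t⟩)
  refine eventuallyPolynomial_finrank N₀ d (X := fun m h => Σ j, (x j ⟶ Y.obj m h)) code ?_ ?_ ?_
    (fun m h => S (Y.obj m h)) ?_
  · rintro m h ⟨j, f⟩ ⟨j', g⟩ hfg
    obtain ⟨h1, h2⟩ := Prod.mk.inj hfg
    have h1' := e'.injective h1
    obtain ⟨b⟩ := Y.nonemptyB
    obtain rfl : j = j' := congrArg Sigma.fst (congrFun h1' b)
    congr 1
    refine Y.ext f g ?_ fun i t ht => ?_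
    · funext b
      exact eq_of_heq (Sigma.mk.inj (congrFun h1' b)).2
    · have h3 := List.map_inj_left.1 (congrFun h2 i) t (by simpa using Nat.lt_succ_of_le ht)
      exact eq_of_heq (Sigma.mk.inj (e.injective h3)).2
  · intro m h z i
    simp [code]
  · rintro m h ⟨j, f⟩
    refine le_trans (Finset.sum_le_sum fun i _ => ?_) ((Y.card_changes_le f).trans (hx j))
    rw [changes_map_range]
    refine Finset.card_le_card fun t => ?_
    simp only [Finset.mem_filter]
    rintro ⟨h1, h2⟩
    exact ⟨h1, fun h3 => h2 (by rw [h3])⟩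
  · intro m h i p h' hp
    obtain ⟨D, hD⟩ := Y.exists_dup m h i p h' hp
    refine ⟨fun z => ⟨z.1, z.2 ≫ D⟩, ?_, hS D⟩
    rintro ⟨j, f⟩
    obtain ⟨h1, h2⟩ := hD _ f
    refine Prod.ext ?_ ?_
    · change e' _ = e' _
      rw [h1]
    · funext i'
      by_cases hi : i' = i
      · subst hi
        simp only [Function.update_self]
        change (List.range ((m + Pi.single i' 1 : Fin r → ℕ) i' + 1)).map _ =
          dup p ((List.range (m i' + 1)).map _)
        rw [dup_map_range _ hp]
        simp [h2]
      · simp only [Function.update_of_ne hi]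
        simp [h2, hi, code]

/-- Smallish modules have eventually polynomial dimension along a word model. -/
theorem finite_and_finrank_of_isSmallish {k : Type u} [Field k] {d : ℕ}
    {M : C ⥤ ModuleCat.{u} k} (hM : IsSmallish deg d M) :
    ∃ f : MvPolynomial (Fin r) ℚ, f.totalDegree ≤ d ∧ ∃ N : ℕ, ∀ m : Fin r → ℕ, ∀ h,
      (∀ i, N ≤ m i) → Module.Finite k (M.obj (Y.obj m h)) ∧
        (Module.finrank k (M.obj (Y.obj m h)) : ℚ) = MvPolynomial.eval (fun i => (m i : ℚ)) f := by
  obtain ⟨F, hF⟩ := hM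
  obtain ⟨n, x, S, K, hx, hS, hK, hdim⟩ := hF.exists_subquotient
  obtain ⟨f, hf, N, hN⟩ := (Y.eventuallyPolynomial_finrank_stable x hx S hS).sub
    (Y.eventuallyPolynomial_finrank_stable x hx K hK)
  refine ⟨f, hf, N, fun m h hm => ?_⟩
  obtain ⟨h1, h2⟩ := hdim (Y.obj m h) (Y.finite_hom x m h)
  have h1' : Module.Finite k (DirectSum ℤ fun i => F.GrPiece i (Y.obj m h)) := h1
  obtain ⟨h3, h4⟩ := finite_and_finrank_of_filtration (hfin := h1')
    (fun i => F.piece i (Y.obj m h)) (F.mono _) (F.exhaustive _) (F.separated _)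
  refine ⟨h3, ?_⟩
  have h5 : Module.finrank k (F.gr.obj (Y.obj m h)) = Module.finrank k (M.obj (Y.obj m h)) :=
    h4.symm
  have h6 := hN m hm
  simp only [dif_pos h] at h6
  rw [← h6, ← h2, ← h5]
  push_cast
  ring

end WordModel

namespace FinTree

/-! ### Edges under contractions -/

/-- Distinct edges that are not contracted have distinct images: a path within the fibers joining
the ends of two edges over the same edge would close up to a cycle. -/
theorem Contraction.edge_injective {S T : FinTree} (f : Contraction S T) {x y x' y' : S.V}
    (h : S.graph.Adj x y) (h' : S.graph.Adj x' y') (hne : f.toFun x ≠ f.toFun y)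
    (heq : s(f.toFun x, f.toFun y) = s(f.toFun x', f.toFun y')) : s(x, y) = s(x', y') := by
  obtain ⟨χ, hx, hy, hχ⟩ := exists_cut S.isTree h
  have key : ∀ w (a b : f.toFun ⁻¹' {w}),
      (S.graph.induce (f.toFun ⁻¹' {w})).Walk a b → χ a → χ b := by
    intro w a b p
    induction p with
    | nil => exact fun h => h
    | @cons a c b hac _ ih =>
      intro ha
      refine ih ?_
      by_contra hc
      obtain ⟨h1, h2⟩ := hχ a c hac ha hc
      refine hne ?_
      rw [← h1, ← h2]
      exact a.2.trans c.2.symm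
  have key' : ∀ a b, f.toFun a = f.toFun b → χ a → χ b := fun a b hab =>
    key (f.toFun b) ⟨a, hab⟩ ⟨b, rfl⟩ ((f.connected_fiber (f.toFun b)).preconnected _ _).some
  rw [Sym2.eq_iff] at heq
  rcases heq with ⟨h1, h2⟩ | ⟨h1, h2⟩
  · obtain ⟨rfl, rfl⟩ := hχ x' y' h' (key' _ _ h1 hx) fun h3 => hy (key' _ _ h2.symm h3)
    rfl
  · obtain ⟨rfl, rfl⟩ := hχ y' x' h'.symm (key' _ _ h1 hx) fun h3 => hy (key' _ _ h2.symm h3)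
    exact Sym2.eq_swap

/-! ### The paths in a subdivided tree -/

section Paths

variable {T : FinTree} {r : ℕ} {e : Fin r → T.graph.Dart} {m : Fin r → ℕ}

/-- The `t`-th vertex of the `i`-th path of `T(e, m)`, or its last vertex if `t` exceeds `m i`. -/
def pathVertex (e : Fin r → T.graph.Dart) (m : Fin r → ℕ) (i : Fin r) (t : ℕ) :
    T.SubdivVertex e m :=
  Quot.mk _ (Sum.inr ⟨i, ⟨min t (m i), by omega⟩⟩)

theorem mk_inr (i : Fin r) (t : Fin (m i + 1)) :
    (Quot.mk _ (Sum.inr ⟨i, t⟩) : T.SubdivVertex e m) = pathVertex e m i t := by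
  have h : (⟨min (t : ℕ) (m i), by omega⟩ : Fin (m i + 1)) = t := Fin.ext (by simp; omega)
  rw [pathVertex, h]

/-- Every edge on the paths of `T(e, m)` is separated by a two-colouring that does not separate any
other such edge. -/
theorem exists_path_cut (he : Function.Injective fun i => (e i).edge) (i : Fin r) {t : ℕ}
    (ht : t < m i) : ∃ χ : T.SubdivVertex e m → Prop,
      ¬ (χ (pathVertex e m i t) ↔ χ (pathVertex e m i (t + 1))) ∧
      ∀ j s, s < m j → ¬ (χ (pathVertex e m j s) ↔ χ (pathVertex e m j (s + 1))) →
        j = i ∧ s = t := by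
  obtain ⟨χ, hx, hy, hχ⟩ := exists_cut T.isTree (e i).adj
  have hloc : ∀ j, j ≠ i → (χ (e j).fst ↔ χ (e j).snd) := by
    intro j hj
    constructor
    · intro h1
      by_contra h2
      obtain ⟨e1, e2⟩ := hχ _ _ (e j).adj h1 h2
      exact hj (he (show s((e j).fst, (e j).snd) = s((e i).fst, (e i).snd) by rw [e1, e2]))
    · intro h1
      by_contra h2
      obtain ⟨e1, e2⟩ := hχ _ _ (e j).adj.symm h1 h2
      exact hj (he (show s((e j).fst, (e j).snd) = s((e i).fst, (e i).snd) by
        rw [e1, e2, Sym2.eq_swap]))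
  refine ⟨Quot.lift (Sum.elim χ fun p =>
    (p.1 = i ∧ (p.2 : ℕ) ≤ t) ∨ (p.1 ≠ i ∧ χ (e p.1).fst)) ?_, ?_, ?_⟩
  · intro p q hpq
    cases hpq with
    | source j =>
      by_cases hj : j = i
      · subst hj; simp [hx]
      · simp [hj]
    | target j =>
      by_cases hj : j = i
      · subst hj; simp [hy, ht]
      · simp [hj, hloc j hj]
  · simp [pathVertex]
    omega
  · intro j s hs h
    by_cases hj : j = i
    · subst hj
      simp only [pathVertex, Sum.elim_inr, true_and, ne_eq, not_true_eq_false, false_and,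
        or_false] at h
      exact ⟨rfl, by omega⟩
    · exact absurd (by simp [pathVertex, hj]) h

theorem pathVertex_ne_succ (he : Function.Injective fun i => (e i).edge) (i : Fin r) {t : ℕ}
    (ht : t < m i) : pathVertex e m i t ≠ pathVertex e m i (t + 1) := by
  obtain ⟨χ, h1, -⟩ := exists_path_cut he i ht
  exact fun h => h1 (by rw [h])

theorem pathEdge_injective (he : Function.Injective fun i => (e i).edge) {i j : Fin r} {t s : ℕ}
    (ht : t < m i) (hs : s < m j)
    (h : s(pathVertex e m j s, pathVertex e m j (s + 1)) =
      s(pathVertex e m i t, pathVertex e m i (t + 1))) : j = i ∧ s = t := by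
  obtain ⟨χ, h1, h2⟩ := exists_path_cut he i ht
  refine h2 j s hs fun h3 => h1 ?_
  rcases Sym2.eq_iff.1 h with ⟨h4, h5⟩ | ⟨h4, h5⟩
  · rwa [h4, h5] at h3
  · rw [h4, h5] at h3
    exact h3.symm

theorem subdivEdge_pathVertex (i : Fin r) {t : ℕ} (ht : t < m i) :
    T.SubdivEdge e m (pathVertex e m i t) (pathVertex e m i (t + 1)) := by
  have h := SubdivEdge.path (e := e) i (⟨t, ht⟩ : Fin (m i))
  rwa [mk_inr, mk_inr] at h

theorem adj_pathVertex (he : Function.Injective fun i => (e i).edge) (i : Fin r) {t : ℕ}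
    (ht : t < m i) :
    (T.subdivGraph e m).Adj (pathVertex e m i t) (pathVertex e m i (t + 1)) :=
  ⟨pathVertex_ne_succ he i ht, Or.inl (subdivEdge_pathVertex i ht)⟩

theorem Contraction.card_changes_le {he : Function.Injective fun i => (e i).edge} {U : FinTree}
    [DecidableEq U.V] (f : Contraction (T.subdivide e he m) U) :
    ∑ i, ((Finset.range (m i)).filter fun t =>
      f.toFun (pathVertex e m i t) ≠ f.toFun (pathVertex e m i (t + 1))).card ≤ U.numEdges := by
  rw [← Finset.card_sigma, ← Set.ncard_coe_finset]
  refine Set.ncard_le_ncard_of_injOn (fun z : Σ _ : Fin r, ℕ =>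
    s(f.toFun (pathVertex e m z.1 z.2), f.toFun (pathVertex e m z.1 (z.2 + 1)))) ?_ ?_
    (Set.toFinite _)
  · rintro ⟨i, t⟩ h
    simp only [Finset.coe_sigma, Set.mem_sigma_iff, Finset.coe_univ, Set.mem_univ, true_and,
      Finset.coe_filter, Finset.mem_range, Set.mem_ofPred_eq] at h
    rcases f.map_adj _ _ (adj_pathVertex he i h.1) with h1 | h1
    · exact absurd h1 h.2
    · exact h1
  · rintro ⟨i, t⟩ h ⟨j, s⟩ h' heq
    simp only [Finset.coe_sigma, Set.mem_sigma_iff, Finset.coe_univ, Set.mem_univ, true_and,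
      Finset.coe_filter, Finset.mem_range, Set.mem_ofPred_eq] at h h'
    have h1 := f.edge_injective (adj_pathVertex he i h.1) (adj_pathVertex he j h'.1) h.2 heq
    obtain ⟨rfl, rfl⟩ := pathEdge_injective he h'.1 h.1 h1
    rfl

theorem Contraction.ext_subdivide {he : Function.Injective fun i => (e i).edge} {U : FinTree}
    {f g : Contraction (T.subdivide e he m) U}
    (hV : ∀ v, f.toFun (Quot.mk _ (Sum.inl v)) = g.toFun (Quot.mk _ (Sum.inl v)))
    (hP : ∀ i t, t ≤ m i → f.toFun (pathVertex e m i t) = g.toFun (pathVertex e m i t)) :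
    f = g := by
  refine Contraction.ext (funext fun a => ?_)
  induction a using Quot.ind with
  | mk q =>
    rcases q with v | ⟨i, t⟩
    · exact hV v
    · have h := hP i t (Nat.lt_succ_iff.1 t.2)
      rwa [← mk_inr] at h

end Paths

/-! ### Contracting one edge of a path -/

section Merge

variable {T : FinTree} {r : ℕ} {e : Fin r → T.graph.Dart} {m m' : Fin r → ℕ} {i : Fin r} {p : ℕ}

/-- The map on glued vertices that merges the vertices `p` and `p + 1` of the `i`-th path. -/
def mergePre (hi : m' i = m i + 1) (hj : ∀ j, j ≠ i → m' j = m j) (hp : p ≤ m i) :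
    T.PreVertex m' → T.PreVertex m
  | Sum.inl v => Sum.inl v
  | Sum.inr ⟨j, t⟩ => Sum.inr ⟨j, ⟨if j = i ∧ p < t then t - 1 else t, by
      have := t.2
      by_cases h : j = i
      · subst h; split_ifs <;> omega
      · have := hj j h; simp [h]; omega⟩⟩

theorem mergePre_surjective (hi : m' i = m i + 1) (hj : ∀ j, j ≠ i → m' j = m j) (hp : p ≤ m i) :
    Function.Surjective (mergePre (T := T) hi hj hp) := by
  rintro (v | ⟨j, s⟩)
  · exact ⟨Sum.inl v, rfl⟩
  · have hs := s.2
    have hlt : (if j = i ∧ p < s then (s : ℕ) + 1 else s) < m' j + 1 := by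
      by_cases h : j = i
      · subst h; split_ifs <;> omega
      · have := hj j h; simp [h]; omega
    refine ⟨Sum.inr ⟨j, ⟨_, hlt⟩⟩, ?_⟩
    simp only [mergePre]
    congr 2
    ext
    simp only
    split_ifs <;> omega

/-- The map `T(e, m') → T(e, m)` that contracts the edge between the vertices `p` and `p + 1` of
the `i`-th path, where `m'` exceeds `m` by one at `i`. -/
def mergeFun (e : Fin r → T.graph.Dart) (hi : m' i = m i + 1) (hj : ∀ j, j ≠ i → m' j = m j)
    (hp : p ≤ m i) : T.SubdivVertex e m' → T.SubdivVertex e m :=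
  Quot.lift (fun q => Quot.mk _ (mergePre hi hj hp q)) fun q q' h => by
    cases h with
    | source j =>
      refine (Quot.sound (Glue.source j)).trans ?_
      simp [mergePre]
    | target j =>
      refine (Quot.sound (Glue.target j)).trans ?_
      simp only [mergePre]
      congr 3
      ext
      by_cases h : j = i
      · subst h; simp; split_ifs <;> omega
      · simp [h, hj j h]

theorem mergeFun_pathVertex (hi : m' i = m i + 1) (hj : ∀ j, j ≠ i → m' j = m j) (hp : p ≤ m i)
    (j : Fin r) (t : ℕ) : mergeFun e hi hj hp (pathVertex e m' j t) =
      pathVertex e m j (if j = i ∧ p < t then t - 1 else t) := by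
  simp only [pathVertex, mergeFun, mergePre]
  congr 3
  ext
  by_cases h : j = i
  · subst h; simp; split_ifs <;> omega
  · simp [h, hj j h]

/-- The vertices of the paths of `T(e, m')` that go to the same vertex before gluing are equal or
adjacent, hence connected within the fiber. -/
theorem reachable_of_mergePre_eq (hi : m' i = m i + 1) (hj : ∀ j, j ≠ i → m' j = m j)
    (hp : p ≤ m i) {w : T.SubdivVertex e m} {a b : T.PreVertex m'}
    (hab : mergePre hi hj hp a = mergePre hi hj hp b)
    (ha : mergeFun e hi hj hp (Quot.mk _ a) = w) (hb : mergeFun e hi hj hp (Quot.mk _ b) = w) :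
    ((T.subdivGraph e m').induce (mergeFun e hi hj hp ⁻¹' {w})).Reachable
      ⟨Quot.mk _ a, ha⟩ ⟨Quot.mk _ b, hb⟩ := by
  have hedge : ∀ (x y : T.SubdivVertex e m') (hx : mergeFun e hi hj hp x = w)
      (hy : mergeFun e hi hj hp y = w), T.SubdivEdge e m' x y →
      ((T.subdivGraph e m').induce (mergeFun e hi hj hp ⁻¹' {w})).Reachable ⟨x, hx⟩ ⟨y, hy⟩ := by
    intro x y hx hy hxy
    by_cases h : x = y
    · subst h; exact SimpleGraph.Reachable.refl _
    · exact SimpleGraph.Adj.reachable (show (T.subdivGraph e m').Adj x y from ⟨h, Or.inl hxy⟩)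
  have hstep : ∀ j (t s : Fin (m' j + 1))
      (ht : mergeFun e hi hj hp (Quot.mk _ (Sum.inr ⟨j, t⟩)) = w)
      (hs : mergeFun e hi hj hp (Quot.mk _ (Sum.inr ⟨j, s⟩)) = w), (s : ℕ) = t + 1 →
      ((T.subdivGraph e m').induce (mergeFun e hi hj hp ⁻¹' {w})).Reachable
        ⟨Quot.mk _ (Sum.inr ⟨j, t⟩), ht⟩ ⟨Quot.mk _ (Sum.inr ⟨j, s⟩), hs⟩ := by
    intro j t s ht hs hts
    refine hedge _ _ ht hs ?_
    rw [mk_inr, mk_inr, hts]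
    exact subdivEdge_pathVertex j (by have := s.2; omega)
  rcases a with v | ⟨j, t⟩ <;> rcases b with v' | ⟨j', s⟩
  · obtain rfl : v = v' := Sum.inl_injective hab
    exact SimpleGraph.Reachable.refl _
  · simp [mergePre] at hab
  · simp [mergePre] at hab
  · have hab' := Sum.inr_injective hab
    obtain rfl : j = j' := congrArg Sigma.fst hab'
    have hval : (if j = i ∧ p < (t : ℕ) then (t : ℕ) - 1 else t) =
        if j = i ∧ p < (s : ℕ) then (s : ℕ) - 1 else s :=
      congrArg Fin.val (eq_of_heq (Sigma.mk.inj hab').2)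
    have hcases : (t : ℕ) = s ∨ (s : ℕ) = t + 1 ∨ (t : ℕ) = s + 1 := by
      split_ifs at hval <;> omega
    rcases hcases with h | h | h
    · obtain rfl := Fin.ext h
      exact SimpleGraph.Reachable.refl _
    · exact hstep j t s ha hb h
    · exact (hstep j s t hb ha h).symm

/-- Vertices of `T(e, m')` whose images are identified by the gluing are connected within the fiber,
since glued pairs of vertices lift to glued pairs. -/
theorem reachable_of_eqvGen (hi : m' i = m i + 1) (hj : ∀ j, j ≠ i → m' j = m j)
    (hp : p ≤ m i) {w : T.SubdivVertex e m} {q q' : T.PreVertex m}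
    (hqq' : Relation.EqvGen (T.Glue e m) q q') : ∀ (a b : T.PreVertex m'),
    mergePre hi hj hp a = q → mergePre hi hj hp b = q' →
    ∀ (ha : mergeFun e hi hj hp (Quot.mk _ a) = w) (hb : mergeFun e hi hj hp (Quot.mk _ b) = w),
    ((T.subdivGraph e m').induce (mergeFun e hi hj hp ⁻¹' {w})).Reachable
      ⟨Quot.mk _ a, ha⟩ ⟨Quot.mk _ b, hb⟩ := by
  induction hqq' with
  | rel q q' h =>
    intro a b haq hbq ha hb
    -- a pair of glued vertices lifts to a pair of glued vertices
    obtain ⟨a₀, b₀, hab₀, ha₀, hb₀⟩ : ∃ a₀ b₀, T.Glue e m' a₀ b₀ ∧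
        mergePre hi hj hp a₀ = q ∧ mergePre hi hj hp b₀ = q' := by
      cases h with
      | source j => exact ⟨_, _, Glue.source j, rfl, by simp [mergePre]⟩
      | target j =>
        refine ⟨_, _, Glue.target j, rfl, ?_⟩
        simp only [mergePre]
        congr 2
        ext
        by_cases h : j = i
        · subst h; simp; split_ifs <;> omega
        · simp [h, hj j h]
    have hw₀ : mergeFun e hi hj hp (Quot.mk _ a₀) = w := by
      rw [← ha]
      change Quot.mk _ _ = Quot.mk _ _
      rw [ha₀, haq]
    have hw₁ : mergeFun e hi hj hp (Quot.mk _ b₀) = w := by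
      rw [← Quot.sound hab₀]
      exact hw₀
    have h1 := reachable_of_mergePre_eq hi hj hp (haq.trans ha₀.symm) ha hw₀
    have h2 := reachable_of_mergePre_eq hi hj hp (hb₀.trans hbq.symm) hw₁ hb
    simp only [Quot.sound hab₀] at h1
    exact h1.trans h2
  | refl q =>
    intro a b haq hbq ha hb
    exact reachable_of_mergePre_eq hi hj hp (haq.trans hbq.symm) ha hb
  | symm q q' _ ih => exact fun a b haq hbq ha hb => (ih b a hbq haq hb ha).symm
  | trans q₁ q₂ q₃ h₁ _ ih₁ ih₂ =>
    intro a b haq hbq ha hb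
    obtain ⟨c, hc⟩ := mergePre_surjective hi hj hp q₂
    have hcw : mergeFun e hi hj hp (Quot.mk _ c) = w := by
      rw [← ha]
      change Quot.mk _ _ = Quot.mk _ _
      rw [hc, haq]
      exact (Quot.eqvGen_sound h₁).symm
    exact (ih₁ a c haq hc ha hcw).trans (ih₂ c b hc hbq hcw hb)

theorem mergeFun_subdivEdge (hi : m' i = m i + 1) (hj : ∀ j, j ≠ i → m' j = m j) (hp : p ≤ m i)
    {x y : T.SubdivVertex e m'} (h : T.SubdivEdge e m' x y) :
    mergeFun e hi hj hp x = mergeFun e hi hj hp y ∨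
      T.SubdivEdge e m (mergeFun e hi hj hp x) (mergeFun e hi hj hp y) := by
  cases h with
  | old u v huv hne => exact Or.inr (SubdivEdge.old u v huv hne)
  | path j t =>
    rw [mk_inr, mk_inr, mergeFun_pathVertex, mergeFun_pathVertex]
    have ht := t.2
    by_cases h : j = i
    · subst h
      simp only [true_and, Fin.val_castSucc, Fin.val_succ]
      by_cases h1 : p < t
      · right
        rw [if_pos h1, if_pos (by omega), show (t : ℕ) + 1 - 1 = t - 1 + 1 by omega]
        exact subdivEdge_pathVertex j (by omega)
      · by_cases h2 : p < (t : ℕ) + 1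
        · left
          rw [if_neg h1, if_pos h2, Nat.add_sub_cancel]
        · right
          rw [if_neg h1, if_neg h2]
          exact subdivEdge_pathVertex j (by omega)
    · right
      have := hj j h
      simp only [h, false_and, if_false, Fin.val_castSucc, Fin.val_succ]
      exact subdivEdge_pathVertex j (by omega)

/-- The contraction `T(e, m') → T(e, m)` of the edge between the vertices `p` and `p + 1` of the
`i`-th path, where `m'` exceeds `m` by one at `i`. -/
def merge (e : Fin r → T.graph.Dart) (he : Function.Injective fun i => (e i).edge)
    (hi : m' i = m i + 1) (hj : ∀ j, j ≠ i → m' j = m j) (hp : p ≤ m i) :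
    Contraction (T.subdivide e he m') (T.subdivide e he m) where
  toFun := mergeFun e hi hj hp
  map_adj x y h := by
    by_cases hxy : mergeFun e hi hj hp x = mergeFun e hi hj hp y
    · exact Or.inl hxy
    right
    refine ⟨hxy, ?_⟩
    rcases h.2 with h' | h'
    · exact Or.inl ((mergeFun_subdivEdge hi hj hp h').resolve_left hxy)
    · exact Or.inr ((mergeFun_subdivEdge hi hj hp h').resolve_left fun h => hxy h.symm)
  connected_fiber w := by
    have hne : Nonempty (mergeFun e hi hj hp ⁻¹' {w}) := by
      induction w using Quot.ind with
      | mk q =>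
        obtain ⟨a, ha⟩ := mergePre_surjective hi hj hp q
        exact ⟨⟨Quot.mk _ a, congrArg (Quot.mk _) ha⟩⟩
    refine @SimpleGraph.Connected.mk _ _ ?_ hne
    rintro ⟨x, hx⟩ ⟨y, hy⟩
    induction x using Quot.ind with
    | mk a =>
      induction y using Quot.ind with
      | mk b =>
        refine reachable_of_eqvGen hi hj hp (Quot.eqvGen_exact ?_) a b rfl rfl hx hy
        exact Eq.trans (b := w) hx (Eq.symm hy)

end Merge

end FinTree

/-! ### Leaves of subdivided trees -/

namespace FinTree

variable {T : FinTree} {r : ℕ} {e : Fin r → T.graph.Dart} {m : Fin r → ℕ}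

/-- The extension of a two-colouring of `T` to `T(e, m)`, where all `m i ≥ 1`: an inner vertex of a
path satisfies the extension if both ends of the path do. -/
def extendColoring (hm : ∀ i, 1 ≤ m i) (χ : T.V → Prop) : T.SubdivVertex e m → Prop :=
  Quot.lift (Sum.elim χ fun p => if (p.2 : ℕ) = 0 then χ (e p.1).fst else
    if (p.2 : ℕ) = m p.1 then χ (e p.1).snd else χ (e p.1).fst ∧ χ (e p.1).snd) fun q q' h => by
  cases h with
  | source i => simp
  | target i => simp [Nat.ne_of_gt (hm i)]

/-- A neighbour `y` of `x` in `T` gives a neighbour of `x` in `T(e, m)` that behaves like `y` for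
two-colourings of `T`. -/
theorem exists_adj_subdivide (hm : ∀ i, 1 ≤ m i) {x y : T.V} (h : T.graph.Adj x y) :
    ∃ a, (T.subdivGraph e m).Adj (Quot.mk _ (Sum.inl x)) a ∧
      ∀ χ : T.V → Prop, χ x → (extendColoring hm χ a ↔ χ y) := by
  have key : ∀ a, (T.SubdivEdge e m (Quot.mk _ (Sum.inl x)) a ∨
      T.SubdivEdge e m a (Quot.mk _ (Sum.inl x))) →
      (∀ χ : T.V → Prop, χ x → (extendColoring hm χ a ↔ χ y)) →
      (T.subdivGraph e m).Adj (Quot.mk _ (Sum.inl x)) a := by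
    refine fun a ha hχ => ⟨fun hax => ?_, ha⟩
    have h1 := hχ (fun z => z = x) rfl
    rw [← hax] at h1
    exact h.ne' (h1.1 rfl)
  by_cases hi : ∀ i, (e i).edge ≠ s(x, y)
  · have h1 : ∀ χ : T.V → Prop, χ x →
        (extendColoring hm χ (Quot.mk _ (Sum.inl y) : T.SubdivVertex e m) ↔ χ y) :=
      fun χ _ => Iff.rfl
    exact ⟨_, key _ (Or.inl (SubdivEdge.old x y h hi)) h1, h1⟩
  · push Not at hi
    obtain ⟨i, hi⟩ := hi
    have hmi := hm i
    have hi' : s((e i).fst, (e i).snd) = s(x, y) := hi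
    rw [Sym2.eq_iff] at hi'
    rcases hi' with ⟨rfl, rfl⟩ | ⟨rfl, rfl⟩
    · have h1 : ∀ χ : T.V → Prop, χ (e i).fst →
          (extendColoring hm χ (pathVertex e m i 1) ↔ χ (e i).snd) := by
        intro χ hχ
        simp only [extendColoring, pathVertex, Sum.elim_inr, hχ, true_and]
        split_ifs <;> first | rfl | omega
      refine ⟨_, key _ (Or.inl ?_) h1, h1⟩
      rw [Quot.sound (Glue.source i), mk_inr]
      exact subdivEdge_pathVertex i hmi
    · have h1 : ∀ χ : T.V → Prop, χ (e i).snd →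
          (extendColoring hm χ (pathVertex e m i (m i - 1)) ↔ χ (e i).fst) := by
        intro χ hχ
        simp only [extendColoring, pathVertex, Sum.elim_inr, hχ, and_true]
        split_ifs <;> first | rfl | omega
      refine ⟨_, key _ (Or.inr ?_) h1, h1⟩
      have h2 := subdivEdge_pathVertex (e := e) i (show m i - 1 < m i by omega)
      rw [Nat.sub_add_cancel hmi] at h2
      rw [Quot.sound (Glue.target i), mk_inr]
      exact h2

theorem neighborSet_ncard_eq_one_of_subdivide (hm : ∀ i, 1 ≤ m i) {x : T.V}
    (h : ((T.subdivGraph e m).neighborSet (Quot.mk _ (Sum.inl x))).ncard = 1) :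
    (T.graph.neighborSet x).ncard = 1 := by
  obtain ⟨a, ha⟩ := Set.ncard_eq_one.1 h
  have hadj : ∃ u v, T.graph.Adj u v := by
    have h1 : a ∈ (T.subdivGraph e m).neighborSet (Quot.mk _ (Sum.inl x)) := ha ▸ rfl
    have h2 : ∀ {b c}, T.SubdivEdge e m b c → ∃ u v, T.graph.Adj u v := by
      rintro b c (⟨u, v, huv, _⟩ | ⟨i, t⟩)
      · exact ⟨u, v, huv⟩
      · exact ⟨_, _, (e i).adj⟩
    rcases h1.2 with h3 | h3
    · exact h2 h3
    · exact h2 h3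
  obtain ⟨u, v, huv⟩ := hadj
  have : Nontrivial T.V := ⟨⟨u, v, huv.ne⟩⟩
  obtain ⟨y, hy⟩ := T.isTree.connected.preconnected.exists_adj_of_nontrivial x
  refine Set.ncard_eq_one.2 ⟨y, Set.eq_singleton_iff_unique_mem.2 ⟨hy, fun y' hy' => ?_⟩⟩
  obtain ⟨b, hb, hbχ⟩ := exists_adj_subdivide (e := e) hm hy
  obtain ⟨b', hb', hbχ'⟩ := exists_adj_subdivide (e := e) hm hy'
  have h1 : b ∈ ({a} : Set _) := ha ▸ hb
  have h2 : b' ∈ ({a} : Set _) := ha ▸ hb'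
  have hbb' : b = b' := (Set.mem_singleton_iff.1 h1).trans (Set.mem_singleton_iff.1 h2).symm
  by_contra hne
  have h3 := hbχ (fun z => z ≠ y) hy.ne
  have h4 := hbχ' (fun z => z ≠ y) hy.ne
  rw [hbb'] at h3
  exact (h3.1 (h4.2 hne)) rfl

/-- Replacing edges by paths of positive lengths creates no new leaves. -/
theorem numLeaves_subdivide_le (he : Function.Injective fun i => (e i).edge)
    (hm : ∀ i, 1 ≤ m i) : (T.subdivide e he m).numLeaves ≤ T.numLeaves := by
  refine le_trans (Set.ncard_le_ncard (t := (fun x : T.V =>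
    (Quot.mk _ (Sum.inl x) : T.SubdivVertex e m)) ''
      {x | (T.graph.neighborSet x).ncard = 1}) ?_ (Set.toFinite _)) (Set.ncard_image_le
        (Set.toFinite _))
  intro w hw
  have hw' : ((T.subdivGraph e m).neighborSet w).ncard = 1 := hw
  clear hw
  induction w using Quot.ind with
  | mk q =>
    rcases q with x | ⟨i, t⟩
    · exact ⟨x, neighborSet_ncard_eq_one_of_subdivide hm hw', rfl⟩
    · by_cases h0 : (t : ℕ) = 0
      · obtain rfl : t = 0 := Fin.ext h0
        rw [← Quot.sound (Glue.source i)] at hw' ⊢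
        exact ⟨_, neighborSet_ncard_eq_one_of_subdivide hm hw', rfl⟩
      by_cases h1 : (t : ℕ) = m i
      · obtain rfl : t = Fin.last (m i) := Fin.ext h1
        rw [← Quot.sound (Glue.target i)] at hw' ⊢
        exact ⟨_, neighborSet_ncard_eq_one_of_subdivide hm hw', rfl⟩
      -- an inner vertex of a path has two neighbours
      exfalso
      have ht := t.2
      rw [mk_inr] at hw'
      obtain ⟨a, ha⟩ := Set.ncard_eq_one.1 hw'
      have h2 := adj_pathVertex he i (show (t : ℕ) - 1 < m i by omega)
      rw [Nat.sub_add_cancel (by omega)] at h2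
      have h3 := adj_pathVertex he i (show (t : ℕ) < m i by omega)
      have h4 : pathVertex e m i (t - 1) ∈ ({a} : Set _) := ha ▸ h2.symm
      have h5 : pathVertex e m i (t + 1) ∈ ({a} : Set _) := ha ▸ h3
      have h6 : pathVertex e m i (t - 1) = pathVertex e m i (t + 1) :=
        (Set.mem_singleton_iff.1 h4).trans (Set.mem_singleton_iff.1 h5).symm
      have h7 := (pathEdge_injective he (show (t : ℕ) < m i by omega)
        (show (t : ℕ) - 1 < m i by omega) (by
          rw [Nat.sub_add_cancel (by omega), h6, Sym2.eq_swap])).2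
      omega

end FinTree

/-! ### Subdivided trees as word models -/

section Models

variable {T : FinTree} {r : ℕ} (e : Fin r → T.graph.Dart)
  (he : Function.Injective fun i => (e i).edge)

/-- The word model given by the trees `T(e, m)` in the opposite of a category of trees with extra
structure. Here `tree` forgets the extra structure and `toContraction` turns morphisms into
contractions. A contraction `T(e, m) → U` is described by the images of the vertices of `T` and
of the vertices of the paths. -/
def treeWordModel {C : Type v} [Category.{0} C] (tree : C → FinTree) {N₀ : ℕ}
    (obj : ∀ m : Fin r → ℕ, (∀ i, N₀ ≤ m i) → C)
    (toContraction : ∀ {x m h}, (x ⟶ obj m h) → FinTree.Contraction (T.subdivide e he m) (tree x))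
    (hinj : ∀ {x m h}, Function.Injective (toContraction (x := x) (m := m) (h := h)))
    (hmerge : ∀ {m m' : Fin r → ℕ} {h h'} {i : Fin r} {p : ℕ}
      (hi : m' i = m i + 1) (hj : ∀ j, j ≠ i → m' j = m j) (hp : p ≤ m i),
      ∃ D : obj m h ⟶ obj m' h', ∀ x (f : x ⟶ obj m h),
        toContraction (h := h') (f ≫ D) =
          (FinTree.merge e he hi hj hp).comp (toContraction (m := m) (h := h) f)) :
    WordModel (fun x => (tree x).numEdges) r N₀ where
  obj := obj
  B := T.V
  nonemptyB := T.isTree.connected.nonempty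
  V x := (tree x).V
  base f v := (toContraction f).toFun (Quot.mk _ (Sum.inl v))
  path {_ m _} f i t := (toContraction f).toFun (FinTree.pathVertex e m i t)
  ext f g hb hp := hinj (FinTree.Contraction.ext_subdivide (congrFun hb) hp)
  card_changes_le f := (toContraction f).card_changes_le
  exists_dup m h i p h' hp := by
    have hi : (m + Pi.single i 1 : Fin r → ℕ) i = m i + 1 := by simp
    have hj : ∀ j, j ≠ i → (m + Pi.single i 1 : Fin r → ℕ) j = m j := fun j hj => by simp [hj]
    obtain ⟨D, hD⟩ := hmerge (h := h) (h' := h') hi hj hp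
    refine ⟨D, fun x f => ⟨?_, fun i' t => ?_⟩⟩
    · rw [hD]
      rfl
    · rw [hD]
      exact congrArg (toContraction f).toFun (FinTree.mergeFun_pathVertex hi hj hp i' t)

/-- The trees `T(e, m)`. -/
def freeTreeWordModel : WordModel (fun x : FinTreeᵒᵖ => x.unop.numEdges) r 0 :=
  treeWordModel (C := FinTreeᵒᵖ) (N₀ := 0) e he (fun x => x.unop)
    (fun m _ => Opposite.op (T.subdivide e he m))
    (fun f => f.unop) (fun h => Quiver.Hom.unop_inj h)
    (fun hi hj hp => ⟨Quiver.Hom.op (show T.subdivide e he _ ⟶ T.subdivide e he _ from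
      FinTree.merge e he hi hj hp), fun _ _ => rfl⟩)

/-- The trees `T(e, m)`, rooted at the vertex that comes from a fixed vertex `x` of `T`. -/
def rootedTreeWordModel (x : T.V) :
    WordModel (fun x : RootedTreeᵒᵖ => x.unop.tree.numEdges) r 0 :=
  treeWordModel (C := RootedTreeᵒᵖ) (N₀ := 0) e he (fun x => x.unop.tree)
    (fun m _ => Opposite.op ⟨T.subdivide e he m, T.subdivideVertex e he m x⟩)
    (fun f => f.unop.1) (fun h => Quiver.Hom.unop_inj (Subtype.ext h))
    (fun {m m' _ _ _ _} hi hj hp => ⟨Quiver.Hom.op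
      (show (⟨T.subdivide e he m', T.subdivideVertex e he m' x⟩ : RootedTree) ⟶
        ⟨T.subdivide e he m, T.subdivideVertex e he m x⟩ from
      ⟨FinTree.merge e he hi hj hp, rfl⟩), fun _ _ => rfl⟩)

/-- The trees `T(e, m)` with all `m i ≥ 1`, where `T` has at most `l` leaves. -/
def boundedTreeWordModel {l : ℕ} (hl : T.numLeaves ≤ l) :
    WordModel (fun x : (BoundedTree l)ᵒᵖ => x.unop.obj.numEdges) r 1 :=
  treeWordModel (C := (BoundedTree l)ᵒᵖ) (N₀ := 1) e he (fun x => x.unop.obj)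
    (fun m h => Opposite.op ⟨T.subdivide e he m, (FinTree.numLeaves_subdivide_le he h).trans hl⟩)
    (fun f => f.unop.hom) (fun h => Quiver.Hom.unop_inj (InducedCategory.hom_ext h))
    (fun {m m' h h' _ _} hi hj hp => ⟨Quiver.Hom.op
      (show (⟨T.subdivide e he m', (FinTree.numLeaves_subdivide_le he h').trans hl⟩ :
          BoundedTree l) ⟶
        ⟨T.subdivide e he m, (FinTree.numLeaves_subdivide_le he h).trans hl⟩ from
      ObjectProperty.homMk (FinTree.merge e he hi hj hp)), fun _ _ => rfl⟩)

end Models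

end TreeModules

theorem theorem2 {k : Type u} [Field k] (d r : ℕ) (T : TreeModules.FinTree)
    (e : Fin r → T.graph.Dart) (he : Function.Injective fun i => (e i).edge) :
    -- modules over the opposite of the category of trees
    (∀ M : TreeModules.FinTreeᵒᵖ ⥤ ModuleCat.{u} k, TreeModules.IsSmallishTree d M →
      ∃ f : MvPolynomial (Fin r) ℚ, f.totalDegree ≤ d ∧
        ∃ N : ℕ, ∀ m : Fin r → ℕ, (∀ i, N ≤ m i) →
          Module.Finite k (M.obj (Opposite.op (T.subdivide e he m))) ∧
          (Module.finrank k (M.obj (Opposite.op (T.subdivide e he m))) : ℚ) =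
            MvPolynomial.eval (fun i => (m i : ℚ)) f) ∧
    -- modules over the opposite of the category of rooted trees, with `T` rooted at `x`
    (∀ M : TreeModules.RootedTreeᵒᵖ ⥤ ModuleCat.{u} k, TreeModules.IsSmallishRooted d M →
      ∀ x : T.V, ∃ f : MvPolynomial (Fin r) ℚ, f.totalDegree ≤ d ∧
        ∃ N : ℕ, ∀ m : Fin r → ℕ, (∀ i, N ≤ m i) →
          Module.Finite k
            (M.obj (Opposite.op ⟨T.subdivide e he m, T.subdivideVertex e he m x⟩)) ∧
          (Module.finrank k
            (M.obj (Opposite.op ⟨T.subdivide e he m, T.subdivideVertex e he m x⟩)) : ℚ) =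
            MvPolynomial.eval (fun i => (m i : ℚ)) f) ∧
    -- modules over the opposite of the category of trees with at most `l` leaves
    (∀ l : ℕ, 2 ≤ l → T.numLeaves ≤ l →
      ∀ M : (TreeModules.BoundedTree l)ᵒᵖ ⥤ ModuleCat.{u} k, TreeModules.IsSmallishBounded d M →
      ∃ f : MvPolynomial (Fin r) ℚ, f.totalDegree ≤ d ∧
        ∃ N : ℕ, ∀ m : Fin r → ℕ, (∀ i, N ≤ m i) →
          ∃ hl : (T.subdivide e he m).numLeaves ≤ l,
            Module.Finite k (M.obj (Opposite.op ⟨T.subdivide e he m, hl⟩)) ∧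
            (Module.finrank k (M.obj (Opposite.op ⟨T.subdivide e he m, hl⟩)) : ℚ) =
              MvPolynomial.eval (fun i => (m i : ℚ)) f) := by
  refine ⟨fun M hM => ?_, fun M hM x => ?_, fun l _ hl M hM => ?_⟩
  · obtain ⟨f, hf, N, hN⟩ :=
      (TreeModules.freeTreeWordModel e he).finite_and_finrank_of_isSmallish hM
    exact ⟨f, hf, N, fun m hm => hN m (fun _ => Nat.zero_le _) hm⟩
  · obtain ⟨f, hf, N, hN⟩ :=
      (TreeModules.rootedTreeWordModel e he x).finite_and_finrank_of_isSmallish hM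
    exact ⟨f, hf, N, fun m hm => hN m (fun _ => Nat.zero_le _) hm⟩
  · obtain ⟨f, hf, N, hN⟩ :=
      (TreeModules.boundedTreeWordModel e he hl).finite_and_finrank_of_isSmallish hM
    refine ⟨f, hf, max N 1, fun m hm => ?_⟩
    have hm1 : ∀ i, 1 ≤ m i := fun i => (le_max_right _ _).trans (hm i)
    exact ⟨(TreeModules.FinTree.numLeaves_subdivide_le he hm1).trans hl,
      hN m hm1 fun i => (le_max_left _ _).trans (hm i)⟩
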